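/- **Proposition 3.3.** Let $X$ be a compact connected Kähler manifold. For a sheaf $\mathscr F$ of $\mathcal O_X$-modules let $\mathcal J^1(\mathscr F)=\mathscr F\oplus\Omega^1(\mathscr F)$, where $\Omega^1(\mathscr F)=\Omega^1_X\otimes_{\mathcal O_X}\mathscr F$, with the $\mathcal O_X$-module structure $f\cdot(\sigma\oplus\theta)=f\sigma\oplus(f\theta+df\otimes\sigma)$. A holomorphic connection on $\mathscr F$ is an $\mathcal O_X$-linear section of the projection $\pi\colon\mathcal J^1(\mathscr F)\to\mathscr F$; equivalently, it is a map $\nabla\colon\mathscr F\to\Omega^1(\mathscr F)$ with $\nabla(f\sigma)=f\nabla\sigma+df\otimes\sigma$. A gauge field on a bounded complex $\mathscr F^\bullet$ of coherent sheaves is a morphism $\psi\colon\mathscr F^\bullet\to\mathcal J^1(\mathscr F^\bullet)$ in the derived category with $\pi\circ\psi=\mathrm{id}$. It induces holomorphic connections $\vartheta^i$ on the cohomology sheaves $\mathscr H^i(\mathscr F^\bullet)$. A family $\nabla^\bullet$ of holomorphic connections on the terms of $\mathscr F^\bullet$ that is compatible with the differentials is a chain map $\mathscr F^\bullet\to\mathcal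 J^1(\mathscr F^\bullet)$ and so defines a gauge field, which is also denoted by $\nabla$. A Hermitian metric on a coherent sheaf $\mathscr F$ is a family of Hermitian inner products on the fibres $\mathscr F_x/\mathfrak m_x\mathscr F_x$ such that the product of any two local sections is locally bounded, and $C^\infty$ outside the singular set $\mathcal S$ of points at which $\mathscr F$ is not locally free. A holomorphic connection on $\mathscr F$ is compatible with the metric if $d\langle s,t\rangle=\langle\nabla s,t\rangle+\langle s,\nabla t\rangle$ on $X\setminus\mathcal S$ for all local sections $s,t$. For a holomorphic connection $\nabla$ with curvature $K_\nabla$ on a Hermitian sheaf put $$\|K_\nabla\|^2=\int_{X\setminus\mathcal S}\langle K_\nabla,K_\nabla\rangle\,d\mathrm{vol},\qquad \langle K_\nabla,K_\nabla\rangle=\tfrac12\sum_{j<k}\mathrm{tr}\big(K_\nabla(e_j,e_k)K_\nabla(e_j,e_k)^*\big),$$ where $(e_j)$ is any unitary frame of the holomorphic tangent space. If the cohomology sheaves of $\mathscr F^\bullet$ carry Hermitian metrics, the Yang–Mills functional at a gauge field $\psi$ is $\mathcal{YM}(\psi)=\sum_i(-1)^i\|K_{\vartheta^i}\|^2$. Let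 $\mathscr A^\bullet,\mathscr B^\bullet$ be bounded complexes of coherent sheaves on $X$ with families $\alpha^\bullet,\beta^\bullet$ of holomorphic connections that are compatible with the differentials, and let $f\colon\mathscr A^\bullet\to\mathscr B^\bullet$ be a morphism of complexes with $(1\otimes f^i)\circ\alpha^i=\beta^i\circ f^i$ for all $i$. Suppose that all $\mathscr A^i$ and $\mathscr B^i$ are Hermitian sheaves, and that all $\alpha^i$ and $\beta^i$ are compatible with the metrics. Let $\mathscr C^\bullet$ be the mapping cone of $f$, so that $\mathscr C^i=\mathscr A^{i+1}\oplus\mathscr B^i$. Then: 1. $\mathscr C^\bullet$ is a bounded complex of coherent sheaves, and $\nabla(a,b)=(\alpha(a),\beta(b))$ defines a unique family of holomorphic connections on the $\mathscr C^i$; this family is compatible with the differential of $\mathscr C^\bullet$, and so is a gauge field on $\mathscr C^\bullet$. 2. $\langle(a,b),(a',b')\rangle=\langle a,a'\rangle+\langle b,b'\rangle$ is a Hermitian metric on each $\mathscr C^i$, and $\nabla^i$ is compatible with it. 3. For these metrics on the terms, the functions $\langle K,K\rangle$ are integrable and $$\sum_i(-1)^i\|K_{\beta^i}\|^2-\sum_i(-1)^i\|K_{\alpha^i}\|^2=\sum_i(-1)^i\|K_{\nabla^i}\|^2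 .$$ 4. For any Hermitian metrics on the cohomology sheaves of $\mathscr A^\bullet$, $\mathscr B^\bullet$ and $\mathscr C^\bullet$, the functions $\langle K,K\rangle$ of the induced connections are integrable and $$\mathcal{YM}(\beta)-\mathcal{YM}(\alpha)=\mathcal{YM}(\nabla).$$ -/

import Mathlib

open CategoryTheory TopologicalSpace Opposite MeasureTheory
open scoped Manifold ContDiff

noncomputable section

/-- The model space `ℂⁿ` of an `n`-dimensional complex manifold. -/
abbrev Cn (n : ℕ) : Type := EuclideanSpace ℂ (Fin n)

namespace HolGauge

variable (n : ℕ) {X : Type} [TopologicalSpace X] [ChartedSpace (Cn n) X]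

variable (X) in
/-- The sheaf `𝒪_X` of holomorphic functions: maps `U → ℂ` that are smooth over `ℂ`. -/
abbrev structureSheaf : Sheaf (Opens.grothendieckTopology (TopCat.of X)) RingCat.{0} :=
  smoothSheafRing 𝓘(ℂ, Cn n) 𝓘(ℂ, ℂ) X ℂ

variable (X) in
/-- Sheaves of `𝒪_X`-modules. -/
abbrev OMod : Type 1 := SheafOfModules.{0} (structureSheaf n X)

variable (X) in
/-- Presheaves of `𝒪_X`-modules. -/
abbrev PMod : Type 1 := PresheafOfModules.{0} (structureSheaf n X).obj

/-- Holomorphic functions on the open set `U`. -/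
abbrev Hol (U : Opens X) : Type := C^∞⟮𝓘(ℂ, Cn n), U; 𝓘(ℂ, ℂ), ℂ⟯

variable {n}

/-- Restriction of holomorphic functions. -/
def Hol.res {U V : Opens X} (h : V ≤ U) : Hol n U →+* Hol n V :=
  ContMDiffMap.restrictRingHom 𝓘(ℂ, Cn n) 𝓘(ℂ, ℂ) ℂ h

@[simp] lemma Hol.res_apply {U V : Opens X} (h : V ≤ U) (f : Hol n U) (x : V) :
    Hol.res h f x = f ⟨x, h x.2⟩ := rfl

@[simp] lemma Hol.res_res {U V W : Opens X} (h : V ≤ U) (h' : W ≤ V) (f : Hol n U) :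
    Hol.res h' (Hol.res h f) = Hol.res (h'.trans h) f := rfl

@[simp] lemma Hol.res_self {U : Opens X} (h : U ≤ U) (f : Hol n U) : Hol.res h f = f := rfl

/-- Sections of `F` over `U`. -/
abbrev Sec (F : PMod n X) (U : Opens X) : Type := F.obj (op U)

instance (F : PMod n X) (U : Opens X) : Module (Hol n U) (Sec F U) :=
  inferInstanceAs (Module ((structureSheaf n X).obj.obj (op U)) (F.obj (op U)))

/-- Restriction of sections. -/
def Sec.res {F : PMod n X} {U V : Opens X} (h : V ≤ U) : Sec F U →+ Sec F V :=
  AddMonoidHom.mk' (fun s => F.map (homOfLE h).op s) (fun s t => map_add (F.map (homOfLE h).op).hom s t)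

lemma Sec.res_smul {F : PMod n X} {U V : Opens X} (h : V ≤ U) (f : Hol n U) (s : Sec F U) :
    Sec.res h (f • s) = Hol.res h f • Sec.res h s :=
  F.map_smul (homOfLE h).op f s

@[simp] lemma Sec.res_res {F : PMod n X} {U V W : Opens X} (h : V ≤ U) (h' : W ≤ V) (s : Sec F U) :
    Sec.res h' (Sec.res h s) = Sec.res (h'.trans h) s :=
  (F.map_comp_apply (homOfLE h).op (homOfLE h').op s).symm

@[simp] lemma Sec.res_self {F : PMod n X} {U : Opens X} (h : U ≤ U) (s : Sec F U) :
    Sec.res h s = s := by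
  have := F.map_id (op U)
  change F.map (𝟙 (op U)) s = s
  rw [this]; rfl

/-- The action of a morphism on sections. -/
def Sec.map {F G : PMod n X} (φ : F ⟶ G) (U : Opens X) : Sec F U →ₗ[Hol n U] Sec G U :=
  (φ.app (op U)).hom

lemma Sec.map_res {F G : PMod n X} (φ : F ⟶ G) {U V : Opens X} (h : V ≤ U) (s : Sec F U) :
    Sec.map φ V (Sec.res h s) = Sec.res h (Sec.map φ U s) :=
  PresheafOfModules.naturality_apply φ (homOfLE h).op s

/-! ## Holomorphic vector fields, one-forms and first jets -/
variable (n) in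
/-- Holomorphic vector fields on `U`, as sections over `U` of the sheaf of `ℂ`-derivations of
`𝒪_X`: a derivation of `𝒪_X(V)` for every open `V ⊆ U`, compatibly with restrictions. -/
def vecFields (U : Opens X) : AddSubgroup (∀ V : Set.Iic U, Derivation ℂ (Hol n V.1) (Hol n V.1)) where
  carrier := {D | ∀ (V W : Opens X) (hV : V ≤ U) (hWV : W ≤ V) (f : Hol n V),
    D ⟨W, hWV.trans hV⟩ (Hol.res hWV f) = Hol.res hWV (D ⟨V, hV⟩ f)}
  add_mem' := by
    intro D E hD hE V W hV hWV f
    simp only [Pi.add_apply, Derivation.add_apply, map_add, hD V W hV hWV f, hE V W hV hWV f]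
  zero_mem' := by intro V W hV hWV f; simp
  neg_mem' := by
    intro D hD V W hV hWV f
    simp only [Pi.neg_apply, Derivation.neg_apply, map_neg, hD V W hV hWV f]

variable (n) in
/-- The type of holomorphic vector fields on `U`. -/
def VecField (U : Opens X) : Type := vecFields n U

namespace VecField
variable {U V W : Opens X}

instance : AddCommGroup (VecField n U) := inferInstanceAs (AddCommGroup (vecFields n U))


/-- The derivation of `𝒪_X(V)` given by a vector field on `U ⊇ V`. -/
def app (D : VecField n U) (h : V ≤ U) : Derivation ℂ (Hol n V) (Hol n V) := D.1 ⟨V, h⟩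

lemma app_res (D : VecField n U) (hV : V ≤ U) (hWV : W ≤ V) (f : Hol n V) :
    D.app (hWV.trans hV) (Hol.res hWV f) = Hol.res hWV (D.app hV f) := D.2 V W hV hWV f

@[ext] lemma ext {D E : VecField n U} (h : ∀ (V : Opens X) (hV : V ≤ U), D.app hV = E.app hV) : D = E :=
  Subtype.ext (funext fun V => h V.1 V.2)

@[simp] lemma app_add (D E : VecField n U) (h : V ≤ U) : (D + E).app h = D.app h + E.app h := rfl
@[simp] lemma app_zero (h : V ≤ U) : (0 : VecField n U).app h = 0 := rfl

instance : SMul (Hol n U) (VecField n U) where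
  smul f D := ⟨fun V => Hol.res V.2 f • D.app V.2, fun V W hV hWV g => by
    simp only [Derivation.smul_apply, smul_eq_mul, map_mul]
    exact congrArg (_ * ·) (D.app_res hV hWV g)⟩

@[simp] lemma app_smul (f : Hol n U) (D : VecField n U) (h : V ≤ U) :
    (f • D).app h = Hol.res h f • D.app h := rfl

instance : Module (Hol n U) (VecField n U) where
  one_smul D := by ext; simp
  mul_smul f g D := by ext; simp [mul_assoc]
  smul_zero f := by ext; simp
  smul_add f D E := by ext; simp [mul_add]
  add_smul f g D := by ext; simp [add_mul]
  zero_smul D := by ext; simp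

def res (h : V ≤ U) : VecField n U →+ VecField n V where
  toFun D := ⟨fun W => D.app (W.2.trans h), fun W W' hW hWW f => D.app_res (hW.trans h) hWW f⟩
  map_zero' := rfl
  map_add' _ _ := rfl

@[simp] lemma app_res' (D : VecField n U) (h : V ≤ U) (hW : W ≤ V) :
    (res h D).app hW = D.app (hW.trans h) := rfl

lemma res_smul (h : V ≤ U) (f : Hol n U) (D : VecField n U) :
    res h (f • D) = Hol.res h f • res h D := rfl

@[simp] lemma res_res (h : V ≤ U) (h' : W ≤ V) (D : VecField n U) :
    res h' (res h D) = res (h'.trans h) D := rfl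

/-- The Lie bracket of two vector fields. -/
def bracket (D E : VecField n U) : VecField n U :=
  ⟨fun V => ⁅D.app V.2, E.app V.2⁆, fun V W hV hWV f => by
    simp only [Derivation.commutator_apply, map_sub]
    refine congrArg₂ _ ?_ ?_
    · exact (congrArg (D.app (hWV.trans hV)) (E.app_res hV hWV f)).trans (D.app_res hV hWV _)
    · exact (congrArg (E.app (hWV.trans hV)) (D.app_res hV hWV f)).trans (E.app_res hV hWV _)⟩

end VecField

variable (n X) in
/-- The holomorphic tangent sheaf `T_X`, as a presheaf of `𝒪_X`-modules. -/
def tangentPresheaf : PMod n X :=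
  letI P : (Opens (TopCat.of X))ᵒᵖ ⥤ Ab :=
    { obj U := AddCommGrpCat.of (VecField n (X := X) U.unop)
      map i := AddCommGrpCat.ofHom (VecField.res i.unop.le) }
  letI (U : (Opens (TopCat.of X))ᵒᵖ) : Module ((structureSheaf n X).obj.obj U) (P.obj U) :=
    inferInstanceAs (Module (Hol n (X := X) U.unop) (VecField n (X := X) U.unop))
  PresheafOfModules.ofPresheaf P fun _ _ i f D => VecField.res_smul i.unop.le f D

/-- Holomorphic one-forms on `U` with values in `F`, as `𝒪_X`-linear morphisms `T_X|_U ⟶ F|_U`.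
Since `T_X` is locally free of finite rank with dual `Ω¹`, these are the sections of `Ω¹ ⊗ F`. -/
def oneForms (F : PMod n X) (U : Opens X) :
    AddSubgroup (∀ V : Set.Iic U, VecField n V.1 →ₗ[Hol n V.1] Sec F V.1) where
  carrier := {θ | ∀ (V W : Opens X) (hV : V ≤ U) (hWV : W ≤ V) (D : VecField n V),
    θ ⟨W, hWV.trans hV⟩ (VecField.res hWV D) = Sec.res hWV (θ ⟨V, hV⟩ D)}
  add_mem' := by
    intro θ η hθ hη V W hV hWV D
    simp only [Pi.add_apply, LinearMap.add_apply, map_add, hθ V W hV hWV D, hη V W hV hWV D]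
  zero_mem' := by intro V W hV hWV f; simp
  neg_mem' := by
    intro D hD V W hV hWV f
    simp only [Pi.neg_apply, LinearMap.neg_apply, map_neg, hD V W hV hWV f]

/-- The type of one-forms on `U` with values in `F`. -/
def OneForm (F : PMod n X) (U : Opens X) : Type := oneForms F U

namespace OneForm
variable {F G : PMod n X} {U V W : Opens X}

instance : AddCommGroup (OneForm F U) := inferInstanceAs (AddCommGroup (oneForms F U))


def app (θ : OneForm F U) (h : V ≤ U) : VecField n V →ₗ[Hol n V] Sec F V := θ.1 ⟨V, h⟩

lemma app_res (θ : OneForm F U) (hV : V ≤ U) (hWV : W ≤ V) (D : VecField n V) :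
    θ.app (hWV.trans hV) (VecField.res hWV D) = Sec.res hWV (θ.app hV D) := θ.2 V W hV hWV D

@[ext] lemma ext {θ η : OneForm F U}
    (h : ∀ (V : Opens X) (hV : V ≤ U) (D : VecField n V), θ.app hV D = η.app hV D) : θ = η :=
  Subtype.ext (funext fun V => LinearMap.ext fun D => h V.1 V.2 D)

@[simp] lemma app_add (θ η : OneForm F U) (h : V ≤ U) : (θ + η).app h = θ.app h + η.app h := rfl
@[simp] lemma app_zero (h : V ≤ U) : (0 : OneForm F U).app h = 0 := rfl

instance : SMul (Hol n U) (OneForm F U) where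
  smul f θ := ⟨fun V => Hol.res V.2 f • θ.app V.2, fun V W hV hWV D => by
    simp only [LinearMap.smul_apply, Sec.res_smul]
    exact congrArg (_ • ·) (θ.app_res hV hWV D)⟩

@[simp] lemma app_smul (f : Hol n U) (θ : OneForm F U) (h : V ≤ U) :
    (f • θ).app h = Hol.res h f • θ.app h := rfl

instance : Module (Hol n U) (OneForm F U) where
  one_smul D := by ext; simp
  mul_smul f g D := by ext; simp [mul_smul]
  smul_zero f := by ext; simp
  smul_add f D E := by ext; simp
  add_smul f g D := by ext; simp [add_smul]
  zero_smul D := by ext; simp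

def res (h : V ≤ U) : OneForm F U →+ OneForm F V where
  toFun θ := ⟨fun W => θ.app (W.2.trans h), fun W W' hW hWW D => θ.app_res (hW.trans h) hWW D⟩
  map_zero' := rfl
  map_add' _ _ := rfl

@[simp] lemma app_res' (θ : OneForm F U) (h : V ≤ U) (hW : W ≤ V) :
    (res h θ).app hW = θ.app (hW.trans h) := rfl

/-- The one-form `df ⊗ s`. -/
def dTensor (f : Hol n U) (s : Sec F U) : OneForm F U :=
  ⟨fun V =>
    { toFun := fun D => D.app le_rfl (Hol.res V.2 f) • Sec.res V.2 s
      map_add' := fun D E => by simp [add_smul]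
      map_smul' := fun g D => by simp [mul_smul] },
   fun V W hV hWV D => by
    simp only [LinearMap.coe_mk, AddHom.coe_mk, Sec.res_smul]
    exact congrArg₂ (· • ·) (D.app_res le_rfl hWV (Hol.res hV f)) (Sec.res_res hV hWV s).symm⟩

@[simp] lemma dTensor_app (f : Hol n U) (s : Sec F U) (h : V ≤ U) (D : VecField n V) :
    (dTensor f s).app h D = D.app le_rfl (Hol.res h f) • Sec.res h s := rfl

/-- The map `1 ⊗ φ` on one-forms. -/
def map (φ : F ⟶ G) (U : Opens X) : OneForm F U →+ OneForm G U where
  toFun θ := ⟨fun V => Sec.map φ V.1 ∘ₗ θ.app V.2, fun V W hV hWV D => by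
    exact (congrArg (Sec.map φ W) (θ.app_res hV hWV D)).trans (Sec.map_res φ hWV _)⟩
  map_zero' := by ext; change Sec.map φ _ 0 = 0; simp
  map_add' θ η := by
    ext V hV D
    exact map_add (Sec.map φ V) (θ.app hV D) (η.app hV D)

@[simp] lemma map_app (φ : F ⟶ G) (θ : OneForm F U) (h : V ≤ U) (D : VecField n V) :
    (map φ U θ).app h D = Sec.map φ V (θ.app h D) := rfl

end OneForm

/-- Sections of the first jet module `J¹(F)` over `U`: the group `F(U) ⊕ Ω¹(F)(U)` with the
`𝒪_X(U)`-action `f · (s ⊕ θ) = f s ⊕ (f θ + df ⊗ s)`. -/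
def Jet (F : PMod n X) (U : Opens X) : Type := Sec F U × OneForm F U

namespace Jet
variable {F G : PMod n X} {U V W : Opens X}

instance : AddCommGroup (Jet F U) := inferInstanceAs (AddCommGroup (Sec F U × OneForm F U))

def mk (s : Sec F U) (θ : OneForm F U) : Jet F U := (s, θ)

@[simp] lemma mk_fst (s : Sec F U) (θ : OneForm F U) : (mk s θ).1 = s := rfl
@[simp] lemma mk_snd (s : Sec F U) (θ : OneForm F U) : (mk s θ).2 = θ := rfl
@[ext] lemma ext {j k : Jet F U} (h₁ : j.1 = k.1) (h₂ : j.2 = k.2) : j = k := Prod.ext h₁ h₂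
@[simp] lemma add_fst (j k : Jet F U) : (j + k).1 = j.1 + k.1 := rfl
@[simp] lemma add_snd (j k : Jet F U) : (j + k).2 = j.2 + k.2 := rfl
@[simp] lemma zero_fst : (0 : Jet F U).1 = 0 := rfl
@[simp] lemma zero_snd : (0 : Jet F U).2 = 0 := rfl

instance : SMul (Hol n U) (Jet F U) where
  smul f j := mk (f • j.1) (f • j.2 + OneForm.dTensor f j.1)

@[simp] lemma smul_fst (f : Hol n U) (j : Jet F U) : (f • j).1 = f • j.1 := rfl
@[simp] lemma smul_snd (f : Hol n U) (j : Jet F U) :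
    (f • j).2 = f • j.2 + OneForm.dTensor f j.1 := rfl

instance : Module (Hol n U) (Jet F U) where
  one_smul j := by ext <;> simp
  mul_smul f g j := by
    ext
    · simp [mul_smul]
    · simp only [smul_snd, OneForm.app_add, OneForm.app_smul, map_mul, LinearMap.add_apply,
        LinearMap.smul_apply, OneForm.dTensor_app, Derivation.leibniz, smul_eq_mul, smul_fst,
        Sec.res_smul, smul_add, add_smul, mul_smul]
      rw [smul_comm (Hol.res _ g)]
      abel
  smul_zero f := by ext <;> simp
  smul_add f j k := by
    ext
    · simp
    · simp; abel
  add_smul f g j := by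
    ext
    · simp [add_smul]
    · simp [add_smul]; abel
  zero_smul j := by ext <;> simp

def res (h : V ≤ U) : Jet F U →+ Jet F V where
  toFun j := mk (Sec.res h j.1) (OneForm.res h j.2)
  map_zero' := by ext <;> simp
  map_add' j k := by ext <;> simp

@[simp] lemma res_fst (h : V ≤ U) (j : Jet F U) : (res h j).1 = Sec.res h j.1 := rfl
@[simp] lemma res_snd (h : V ≤ U) (j : Jet F U) : (res h j).2 = OneForm.res h j.2 := rfl

lemma res_self (h : U ≤ U) (j : Jet F U) : res h j = j := by
  ext
  · simp
  · rfl

lemma res_res (h : V ≤ U) (h' : W ≤ V) (j : Jet F U) : res h' (res h j) = res (h'.trans h) j := by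
  ext
  · simp
  · rfl

lemma res_smul (h : V ≤ U) (f : Hol n U) (j : Jet F U) :
    res h (f • j) = Hol.res h f • res h j := by
  ext
  · simp [Sec.res_smul]
  · simp

def map (φ : F ⟶ G) (U : Opens X) : Jet F U →ₗ[Hol n U] Jet G U where
  toFun j := mk (Sec.map φ U j.1) (OneForm.map φ U j.2)
  map_add' j k := by ext <;> simp
  map_smul' f j := by
    ext
    · simp
    · simp [Sec.map_res]

@[simp] lemma map_fst (φ : F ⟶ G) (j : Jet F U) : (map φ U j).1 = Sec.map φ U j.1 := rfl
@[simp] lemma map_snd (φ : F ⟶ G) (j : Jet F U) : (map φ U j).2 = OneForm.map φ U j.2 := rfl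

lemma map_res (φ : F ⟶ G) (h : V ≤ U) (j : Jet F U) : map φ V (res h j) = res h (map φ U j) := by
  ext
  · simp [Sec.map_res]
  · simp

end Jet

instance (F : PMod n X) (U : (Opens (TopCat.of X))ᵒᵖ) :
    Module ((structureSheaf n X).obj.obj U) (Jet (X := X) F U.unop) :=
  inferInstanceAs (Module (Hol n (X := X) U.unop) (Jet F U.unop))

/-- The presheaf of abelian groups underlying `J¹(F)`. -/
def jetAb (F : PMod n X) : (Opens (TopCat.of X))ᵒᵖ ⥤ Ab where
  obj U := AddCommGrpCat.of (Jet F U.unop)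
  map i := AddCommGrpCat.ofHom (Jet.res i.unop.le)
  map_id U := AddCommGrpCat.hom_ext (AddMonoidHom.ext fun j =>
    Jet.res_self (X := X) (F := F) (U := U.unop) le_rfl j)
  map_comp i k := AddCommGrpCat.hom_ext (AddMonoidHom.ext fun j =>
    (Jet.res_res (X := X) (F := F) i.unop.le k.unop.le j).symm)

instance (F : PMod n X) (U : (Opens (TopCat.of X))ᵒᵖ) :
    Module ((structureSheaf n X).obj.obj U) ((jetAb F).obj U) :=
  inferInstanceAs (Module (Hol n (X := X) U.unop) (Jet F U.unop))

/-- `J¹(F)` as a presheaf of `𝒪_X`-modules. -/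
def jetPresheaf (F : PMod n X) : PMod n X :=
  PresheafOfModules.ofPresheaf (jetAb F) fun _ _ i f D => Jet.res_smul i.unop.le f D

lemma Sec.glue (F : OMod n X) {ι : Type} {V : Opens X} (U : ι → Opens X) (hU : ∀ i, U i ≤ V)
    (hV : V ≤ iSup U) (s : ∀ i, Sec F.val (U i))
    (hs : ∀ i j, Sec.res (inf_le_left : U i ⊓ U j ≤ U i) (s i) = Sec.res inf_le_right (s j)) :
    ∃! t : Sec F.val V, ∀ i, Sec.res (hU i) t = s i := by
  let G : TopCat.Sheaf Ab (TopCat.of X) := ⟨F.val.presheaf, F.isSheaf⟩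
  let sf : ∀ i : ι, ToType (G.1.obj (op (U i))) := s
  exact G.existsUnique_gluing' U V (fun i => homOfLE (hU i)) hV sf hs

lemma Sec.eq_of_locally_eq (F : OMod n X) {ι : Type} {V : Opens X} (U : ι → Opens X)
    (hU : ∀ i, U i ≤ V) (hV : V ≤ iSup U) (s t : Sec F.val V)
    (h : ∀ i, Sec.res (hU i) s = Sec.res (hU i) t) : s = t :=
  TopCat.Sheaf.eq_of_locally_eq' (X := TopCat.of X) (C := Ab) ⟨F.val.presheaf, F.isSheaf⟩
    U V (fun i => homOfLE (hU i)) hV s t h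

lemma OneForm.glue (F : OMod n X) {ι : Type} (U : ι → Opens X) (θ : ∀ i, OneForm F.val (U i))
    (hθ : ∀ i j, OneForm.res (inf_le_left : U i ⊓ U j ≤ U i) (θ i) =
      OneForm.res inf_le_right (θ j)) :
    ∃! η : OneForm F.val (iSup U), ∀ i, OneForm.res (le_iSup U i) η = θ i := by
  have hcov : ∀ V : Opens X, V ≤ iSup U → V ≤ ⨆ i, V ⊓ U i := fun V hV => by
    rw [← inf_iSup_eq]; exact le_inf le_rfl hV
  have key : ∀ (V : Opens X) (hV : V ≤ iSup U) (D : VecField n V), ∃! t : Sec F.val V,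
      ∀ i : ι, Sec.res (inf_le_left : V ⊓ U i ≤ V) t =
        (θ i).app inf_le_right (VecField.res inf_le_left D) := by
    intro V hV D
    refine Sec.glue F (fun i => V ⊓ U i) (fun i => inf_le_left) (hcov V hV) _ fun i j => ?_
    rw [← OneForm.app_res, ← OneForm.app_res]
    have h := congrArg (fun η => OneForm.app η
      (le_inf (inf_le_left.trans inf_le_right) (inf_le_right.trans inf_le_right) :
        (V ⊓ U i) ⊓ (V ⊓ U j) ≤ U i ⊓ U j)
      (VecField.res (inf_le_left.trans inf_le_left) D)) (hθ i j)
    exact h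
  choose t ht htu using fun (V : Opens X) (hV : V ∈ Set.Iic (iSup U)) => key V hV
  beta_reduce at ht htu
  refine ⟨⟨fun V => { toFun := t V.1 V.2, map_add' := ?_, map_smul' := ?_ }, ?_⟩, ?_, ?_⟩
  · intro D E
    symm
    refine htu _ _ _ _ fun i => ?_
    rw [map_add, ht, ht, map_add, map_add]
  · intro f D
    symm
    refine htu _ _ _ _ fun i => ?_
    rw [RingHom.id_apply, Sec.res_smul, ht, VecField.res_smul, map_smul]
  · intro V W hV hWV D
    symm
    refine htu _ _ _ _ fun i => ?_
    rw [Sec.res_res]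
    have h := congrArg (Sec.res (inf_le_inf_right (U i) hWV)) (ht V hV D i)
    rw [Sec.res_res, ← OneForm.app_res] at h
    exact h
  · intro i
    ext V hV D
    have h := ht V (hV.trans (le_iSup U i)) D
    refine Sec.eq_of_locally_eq F (fun j => V ⊓ U j) (fun j => inf_le_left)
      (hcov V (hV.trans (le_iSup U i))) _ _ fun j => ?_
    refine (h j).trans ?_
    rw [← OneForm.app_res]
    have h' := congrArg (fun η => OneForm.app η
      (le_inf (inf_le_left.trans hV) inf_le_right : V ⊓ U j ≤ U i ⊓ U j)
      (VecField.res inf_le_left D)) (hθ i j)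
    exact h'.symm
  · intro η hη
    ext V hV D
    refine htu V hV D _ fun i => ?_
    rw [← OneForm.app_res, ← hη i]
    rfl

lemma jetAb_isSheaf (F : OMod n X) :
    Presheaf.IsSheaf (Opens.grothendieckTopology (TopCat.of X)) (jetAb F.val) := by
  refine (TopCat.Presheaf.isSheaf_iff_isSheafUniqueGluing (X := TopCat.of X)
    (jetAb F.val)).2 ?_
  intro ι U j hj
  obtain ⟨s, hs, hs'⟩ := Sec.glue F U (le_iSup U) le_rfl (fun i => (j i : Jet F.val (U i)).1)
    fun i k => congrArg (fun a : Jet F.val (U i ⊓ U k) => a.1) (hj i k)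
  obtain ⟨θ, hθ, hθ'⟩ := OneForm.glue F U (fun i => (j i : Jet F.val (U i)).2)
    fun i k => congrArg (fun a : Jet F.val (U i ⊓ U k) => a.2) (hj i k)
  refine ⟨Jet.mk s θ, fun i => Jet.ext (hs i) (hθ i), fun y hy => Jet.ext (hs' _ fun i => ?_)
    (hθ' _ fun i => ?_)⟩
  · exact congrArg (fun a : Jet F.val (U i) => a.1) (hy i)
  · exact congrArg (fun a : Jet F.val (U i) => a.2) (hy i)

/-- `J¹(F)` as a sheaf of `𝒪_X`-modules. -/
def jetSheaf (F : OMod n X) : OMod n X where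
  val := jetPresheaf F.val
  isSheaf := jetAb_isSheaf F

/-- The projection `J¹(F) ⟶ F`. -/
def jetProj (F : OMod n X) : jetSheaf F ⟶ F where
  val :=
    { app U := ModuleCat.ofHom (X := Jet (X := X) F.val U.unop) (Y := Sec (X := X) F.val U.unop)
        { toFun := fun j => j.1, map_add' := fun _ _ => rfl, map_smul' := fun _ _ => rfl }
      naturality := fun _ => rfl }

/-- The morphism `J¹(F) ⟶ J¹(G)` induced by `F ⟶ G`, namely `s ⊕ θ ↦ φ(s) ⊕ (1 ⊗ φ)(θ)`. -/
def jetMap {F G : OMod n X} (φ : F ⟶ G) : jetSheaf F ⟶ jetSheaf G where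
  val :=
    { app U := ModuleCat.ofHom (X := Jet (X := X) F.val U.unop) (Y := Jet (X := X) G.val U.unop)
        (Jet.map (X := X) φ.val U.unop)
      naturality := fun i => by
        ext j
        exact Jet.map_res φ.val i.unop.le j }

variable (n X) in
/-- The first jet functor on sheaves of `𝒪_X`-modules. -/
def jetFunctor : OMod n X ⥤ OMod n X where
  obj := jetSheaf
  map := jetMap
  map_id F := rfl
  map_comp φ ψ := rfl

instance : (jetFunctor n X).Additive where
  map_add {F G φ ψ} := by
    ext U j
    rfl

variable (n X) in
/-- The natural projection `J¹ ⟶ 𝟭`. -/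
def jetProjection : jetFunctor n X ⟶ 𝟭 (OMod n X) where
  app := jetProj
  naturality _ _ _ := rfl

/-! ## Holomorphic connections -/

/-- A holomorphic connection on `F`: an `𝒪_X`-linear section of `J¹(F) ⟶ F`. Its second component is
a map `∇ : F ⟶ Ω¹(F)` with `∇(f s) = f ∇ s + df ⊗ s`. -/
structure HolConnection (F : OMod n X) where
  toHom : F ⟶ (jetFunctor n X).obj F
  split : toHom ≫ (jetProjection n X).app F = 𝟙 F

namespace HolConnection

/-- The covariant derivative `∇_D s`. -/
def cov {F : OMod n X} (c : HolConnection F) {U : Opens X} (D : VecField n U) (s : Sec F.val U) :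
    Sec F.val U :=
  OneForm.app (Prod.snd (Sec.map c.toHom.val U s : Jet F.val U)) le_rfl D

/-- The curvature `K(D, E) s = ∇_D ∇_E s - ∇_E ∇_D s - ∇_[D,E] s`. -/
def curvature {F : OMod n X} (c : HolConnection F) {U : Opens X} (D E : VecField n U)
    (s : Sec F.val U) : Sec F.val U :=
  c.cov D (c.cov E s) - c.cov E (c.cov D s) - c.cov (VecField.bracket D E) s

/-- The morphism `φ` is compatible with the connections: `(1 ⊗ φ) ∘ ∇_F = ∇_G ∘ φ`. -/
def Horizontal {F G : OMod n X} (c : HolConnection F) (c' : HolConnection G) (φ : F ⟶ G) : Prop :=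
  c.toHom ≫ (jetFunctor n X).map φ = φ ≫ c'.toHom

end HolConnection

/-! ## Gauge fields on complexes -/

open DerivedCategory

/-- The first jet complex `J¹(K)`. -/
abbrev jetComplex (K : CochainComplex (OMod n X) ℤ) : CochainComplex (OMod n X) ℤ where
  X i := (jetFunctor n X).obj (K.X i)
  d i j := (jetFunctor n X).map (K.d i j)
  shape i j hij := by rw [K.shape i j hij, Functor.map_zero]
  d_comp_d' i j k _ _ := by rw [← Functor.map_comp, K.d_comp_d, Functor.map_zero]

/-- The projection `J¹(K) ⟶ K`. -/
def jetComplexProj (K : CochainComplex (OMod n X) ℤ) : jetComplex K ⟶ K where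
  f i := (jetProjection n X).app (K.X i)
  comm' i j _ := ((jetProjection n X).naturality (K.d i j)).symm

/-- A gauge field on `K`: a morphism `K ⟶ J¹(K)` in the derived category that is a section of
the projection `J¹(K) ⟶ K`. -/
structure GaugeField [HasDerivedCategory (OMod n X)] (K : CochainComplex (OMod n X) ℤ) where
  toHom : Q.obj K ⟶ Q.obj (jetComplex K)
  split : toHom ≫ Q.map (jetComplexProj K) = 𝟙 (Q.obj K)

/-- A family of holomorphic connections on the terms of a complex, compatible with the differentials. -/
structure ConnectionFamily (K : CochainComplex (OMod n X) ℤ) where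
  conn : ∀ i, HolConnection (K.X i)
  compat : ∀ i j, (conn i).Horizontal (conn j) (K.d i j)

namespace ConnectionFamily
variable {K : CochainComplex (OMod n X) ℤ}

/-- The chain map `K ⟶ J¹(K)` given by a compatible family of connections. -/
def toChainMap (c : ConnectionFamily K) : K ⟶ jetComplex K where
  f i := (c.conn i).toHom
  comm' i j _ := c.compat i j

lemma toChainMap_proj (c : ConnectionFamily K) : c.toChainMap ≫ jetComplexProj K = 𝟙 K := by
  ext1 i
  exact (c.conn i).split

/-- The gauge field given by a compatible family of connections. -/
def toGaugeField [HasDerivedCategory (OMod n X)] (c : ConnectionFamily K) : GaugeField K where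
  toHom := Q.map c.toChainMap
  split := by rw [← Functor.map_comp, toChainMap_proj, CategoryTheory.Functor.map_id]

end ConnectionFamily

/-! ## The connections that a gauge field induces on the cohomology sheaves -/

lemma cycles_injective (K : CochainComplex (OMod n X) ℤ) (i : ℤ) (U : Opens X) :
    Function.Injective (Sec.map (K.iCycles i).val U) := by
  have h : Mono ((SheafOfModules.forget _).map (K.iCycles i)) := inferInstance
  exact @PresheafOfModules.injective_of_mono _ _ _ _ _ _ h (op U)

lemma cycles_exact (K : CochainComplex (OMod n X) ℤ) (i j : ℤ) (hj : (ComplexShape.up ℤ).next i = j)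
    (U : Opens X) (s : Sec (K.X i).val U) (hs : Sec.map (K.d i j).val U s = 0) :
    ∃ z, Sec.map (K.iCycles i).val U z = s := by
  let ev := SheafOfModules.evaluation.{0} (structureSheaf n X) (op U)
  have : ev.PreservesZeroMorphisms := ⟨fun _ _ => rfl⟩
  have hl := Limits.KernelFork.mapIsLimit _ (K.cyclesIsKernel i j hj) ev
  let k : ModuleCat.of _ (LinearMap.ker (ev.map (K.d i j)).hom) ⟶ ev.obj (K.X i) :=
    ModuleCat.ofHom (LinearMap.ker (ev.map (K.d i j)).hom).subtype
  have hk : k ≫ ev.map (K.d i j) = 0 := by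
    ext x
    exact x.2
  obtain ⟨l, hl'⟩ := Limits.KernelFork.IsLimit.lift' hl k hk
  have hs' : s ∈ LinearMap.ker (ev.map (K.d i j)).hom := hs
  refine ⟨l.hom ⟨s, hs'⟩, ?_⟩
  exact congrArg (fun φ => φ.hom ⟨s, hs'⟩) hl'

lemma isIso_of_bijective {F G : OMod n X} (φ : F ⟶ G)
    (h : ∀ U : Opens X, Function.Bijective (Sec.map φ.val U)) : IsIso φ := by
  have : Mono φ := (SheafOfModules.forget _).mono_of_mono_map
    (PresheafOfModules.mono_of_injective fun U => (h U.unop).1)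
  have : Epi φ := (SheafOfModules.forget _).epi_of_epi_map
    (PresheafOfModules.epi_of_surjective fun U => (h U.unop).2)
  exact isIso_of_mono_of_epi φ

/-- The comparison map `J¹(Ker d) ⟶ Ker J¹(d)`; it is an isomorphism. -/
def jetCycles (K : CochainComplex (OMod n X) ℤ) (i : ℤ) :
    (jetFunctor n X).obj (K.cycles i) ⟶ (jetComplex K).cycles i :=
  (jetComplex K).liftCycles ((jetFunctor n X).map (K.iCycles i)) _ rfl
    (((jetFunctor n X).map_comp _ _).symm.trans
      ((congrArg _ (K.iCycles_d i _)).trans (Functor.map_zero _ _ _)))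

@[simp]
lemma jetCycles_i (K : CochainComplex (OMod n X) ℤ) (i : ℤ) :
    jetCycles K i ≫ (jetComplex K).iCycles i = (jetFunctor n X).map (K.iCycles i) :=
  HomologicalComplex.liftCycles_i _ _ _ _ _

instance (K : CochainComplex (OMod n X) ℤ) (i : ℤ) : IsIso (jetCycles K i) := by
  refine isIso_of_bijective _ fun U => ⟨fun a b hab => ?_, fun y => ?_⟩
  · have h := congrArg (Sec.map ((jetComplex K).iCycles i).val U) hab
    have e : ∀ a, Sec.map ((jetComplex K).iCycles i).val U (Sec.map (jetCycles K i).val U a) =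
        Jet.map (K.iCycles i).val U a :=
      fun a => congrArg (fun φ => Sec.map φ.val U a) (jetCycles_i K i)
    rw [e, e] at h
    refine Jet.ext ?_ ?_
    · exact cycles_injective K i U (congrArg Prod.fst h)
    · refine OneForm.ext fun V hV D => cycles_injective K i V ?_
      exact congrArg (fun j : Jet _ _ => OneForm.app (Prod.snd j) hV D) h
  · let w : Jet (K.X i).val U := Sec.map ((jetComplex K).iCycles i).val U y
    have hw : Jet.map (K.d i ((ComplexShape.up ℤ).next i)).val U w = 0 :=
      congrArg (fun φ : (jetComplex K).cycles i ⟶ _ => Sec.map φ.val U y) ((jetComplex K).iCycles_d i ((ComplexShape.up ℤ).next i))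
    obtain ⟨z, hz⟩ := cycles_exact K i _ rfl U w.1 (congrArg Prod.fst hw)
    have hD : ∀ (V : Opens X) (hV : V ≤ U) (D : VecField n V),
        Sec.map (K.d i ((ComplexShape.up ℤ).next i)).val V (OneForm.app w.2 hV D) = 0 :=
      fun V hV D => congrArg (fun j : Jet _ _ => OneForm.app (Prod.snd j) hV D) hw
    choose t ht using fun (V : Opens X) (hV : V ∈ Set.Iic U) (D : VecField n V) =>
      cycles_exact K i _ rfl V _ (hD V hV D)
    let η : OneForm (K.cycles i).val U :=
      ⟨fun V =>
        { toFun := t V.1 V.2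
          map_add' := fun D E => cycles_injective K i V.1 (by simp [ht])
          map_smul' := fun f D => cycles_injective K i V.1 (by simp [ht]) },
        fun V W hV hWV D => cycles_injective K i W (by
          rw [Sec.map_res]
          exact (ht _ _ _).trans ((OneForm.app_res w.2 hV hWV D).trans
            (congrArg (Sec.res hWV) (ht V hV D).symm)))⟩
    refine ⟨Jet.mk z η, cycles_injective (jetComplex K) i U ?_⟩
    refine (congrArg (fun φ => Sec.map φ.val U (Jet.mk z η)) (jetCycles_i K i)).trans ?_
    refine Jet.ext hz (OneForm.ext fun V hV D => ?_)
    exact ht V hV D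

lemma toCycles_jet (K : CochainComplex (OMod n X) ℤ) (i j : ℤ) :
    (jetComplex K).toCycles i j = (jetFunctor n X).map (K.toCycles i j) ≫ jetCycles K j := by
  rw [← cancel_mono ((jetComplex K).iCycles j), Category.assoc, jetCycles_i,
    HomologicalComplex.toCycles_i, ← Functor.map_comp, HomologicalComplex.toCycles_i]

/-- The comparison map `Hⁱ(J¹(K)) ⟶ J¹(Hⁱ(K))`. -/
def jetHomology (K : CochainComplex (OMod n X) ℤ) (i : ℤ) :
    (jetComplex K).homology i ⟶ (jetFunctor n X).obj (K.homology i) :=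
  Limits.Cofork.IsColimit.desc ((jetComplex K).homologyIsCokernel _ i rfl)
    (inv (jetCycles K i) ≫ (jetFunctor n X).map (K.homologyπ i)) (by
      rw [Limits.zero_comp, toCycles_jet, Category.assoc, IsIso.hom_inv_id_assoc, ← Functor.map_comp,
        HomologicalComplex.toCycles_comp_homologyπ, Functor.map_zero])

@[simp]
lemma homologyπ_jetHomology (K : CochainComplex (OMod n X) ℤ) (i : ℤ) :
    (jetComplex K).homologyπ i ≫ jetHomology K i =
      inv (jetCycles K i) ≫ (jetFunctor n X).map (K.homologyπ i) :=
  Limits.Cofork.IsColimit.π_desc ((jetComplex K).homologyIsCokernel _ i rfl)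

lemma jetHomology_proj (K : CochainComplex (OMod n X) ℤ) (i : ℤ) :
    jetHomology K i ≫ (jetProjection n X).app (K.homology i) =
      HomologicalComplex.homologyMap (jetComplexProj K) i := by
  rw [← cancel_epi ((jetComplex K).homologyπ i), reassoc_of% (homologyπ_jetHomology K i),
    HomologicalComplex.homologyπ_naturality, (jetProjection n X).naturality, IsIso.inv_comp_eq,
    ← Category.assoc (jetCycles K i)]
  congr 1
  rw [← cancel_mono (K.iCycles i), Category.assoc, HomologicalComplex.cyclesMap_i,
    reassoc_of% (jetCycles_i K i)]
  exact ((jetProjection n X).naturality (K.iCycles i)).symm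

section
variable [HasDerivedCategory (OMod n X)]

/-- The cohomology of `K` as an object of the derived category is the cohomology of `K`. -/
def derivedHomologyIso (K : CochainComplex (OMod n X) ℤ) (i : ℤ) :
    (homologyFunctor (OMod n X) i).obj (Q.obj K) ≅ K.homology i :=
  (homologyFunctorFactors (OMod n X) i).app K

lemma derivedHomologyIso_naturality {K L : CochainComplex (OMod n X) ℤ} (φ : K ⟶ L) (i : ℤ) :
    (homologyFunctor (OMod n X) i).map (Q.map φ) ≫ (derivedHomologyIso L i).hom =
      (derivedHomologyIso K i).hom ≫ HomologicalComplex.homologyMap φ i :=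
  homologyFunctorFactors_hom_naturality φ i

variable {K : CochainComplex (OMod n X) ℤ}

/-- The holomorphic connection `ϑⁱ` that a gauge field `ψ` induces on the cohomology sheaf `Hⁱ(K)`:
the composite `Hⁱ(K) ⟶ Hⁱ(J¹(K)) ⟶ J¹(Hⁱ(K))` of `Hⁱ(ψ)` and the comparison map. -/
def GaugeField.onCohomology (ψ : GaugeField K) (i : ℤ) : HolConnection (K.homology i) where
  toHom := (derivedHomologyIso K i).inv ≫ (homologyFunctor (OMod n X) i).map ψ.toHom ≫
    (derivedHomologyIso (jetComplex K) i).hom ≫ jetHomology K i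
  split := by
    simp only [Category.assoc]
    rw [jetHomology_proj, ← derivedHomologyIso_naturality, ← Functor.map_comp_assoc, ψ.split]
    simp

end


/-! ## The connection on the mapping cone -/

namespace ConnectionFamily
open CochainComplex
variable {A B : CochainComplex (OMod n X) ℤ}

/-- The section `(a, b) ↦ (α a, β b)` of the jet projection on `Cⁱ = Aⁱ⁺¹ ⊕ Bⁱ`. -/
def coneHom (α : ConnectionFamily A) (β : ConnectionFamily B) (f : A ⟶ B) (i : ℤ) :
    (mappingCone f).X i ⟶ (jetFunctor n X).obj ((mappingCone f).X i) :=
  (mappingCone.fst f).1.v i (i + 1) rfl ≫ (α.conn (i + 1)).toHom ≫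
      (jetFunctor n X).map ((mappingCone.inl f).v (i + 1) i (by lia)) +
    (mappingCone.snd f).v i i (add_zero i) ≫ (β.conn i).toHom ≫
      (jetFunctor n X).map ((mappingCone.inr f).f i)

lemma inl_coneHom (α : ConnectionFamily A) (β : ConnectionFamily B) (f : A ⟶ B) (i : ℤ) :
    (mappingCone.inl f).v (i + 1) i (by lia) ≫ coneHom α β f i =
      (α.conn (i + 1)).toHom ≫
        (jetFunctor n X).map ((mappingCone.inl f).v (i + 1) i (by lia)) := by
  simp [coneHom]

lemma inr_coneHom (α : ConnectionFamily A) (β : ConnectionFamily B) (f : A ⟶ B) (i : ℤ) :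
    (mappingCone.inr f).f i ≫ coneHom α β f i =
      (β.conn i).toHom ≫ (jetFunctor n X).map ((mappingCone.inr f).f i) := by
  simp [coneHom]

lemma cone_aux {𝒞 : Type*} [Category 𝒞] [Preadditive 𝒞] (J : 𝒞 ⥤ 𝒞) [J.Additive]
    {A₁ A₂ B₁ B₂ C₁ C₂ : 𝒞} {dA : A₁ ⟶ A₂} {dB : B₁ ⟶ B₂} {dC : C₁ ⟶ C₂} {φ : A₁ ⟶ B₂}
    {l₁ : A₁ ⟶ C₁} {l₂ : A₂ ⟶ C₂} {r₁ : B₁ ⟶ C₁} {r₂ : B₂ ⟶ C₂}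
    {a₁ : A₁ ⟶ J.obj A₁} {a₂ : A₂ ⟶ J.obj A₂} {b₁ : B₁ ⟶ J.obj B₁} {b₂ : B₂ ⟶ J.obj B₂}
    {c₁ : C₁ ⟶ J.obj C₁} {c₂ : C₂ ⟶ J.obj C₂}
    (hl₁ : l₁ ≫ c₁ = a₁ ≫ J.map l₁) (hl₂ : l₂ ≫ c₂ = a₂ ≫ J.map l₂)
    (hr₁ : r₁ ≫ c₁ = b₁ ≫ J.map r₁) (hr₂ : r₂ ≫ c₂ = b₂ ≫ J.map r₂)
    (ha : a₁ ≫ J.map dA = dA ≫ a₂) (hb : b₁ ≫ J.map dB = dB ≫ b₂)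
    (hφ : a₁ ≫ J.map φ = φ ≫ b₂)
    (hl : l₁ ≫ dC = φ ≫ r₂ - dA ≫ l₂) (hr : r₁ ≫ dC = dB ≫ r₂) :
    l₁ ≫ c₁ ≫ J.map dC = l₁ ≫ dC ≫ c₂ ∧ r₁ ≫ c₁ ≫ J.map dC = r₁ ≫ dC ≫ c₂ := by
  constructor
  · rw [reassoc_of% hl₁, ← J.map_comp, reassoc_of% hl, hl, Preadditive.sub_comp, Category.assoc,
      Category.assoc, hr₂, hl₂, J.map_sub, Preadditive.comp_sub, J.map_comp, J.map_comp,
      reassoc_of% hφ, reassoc_of% ha]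
  · rw [reassoc_of% hr₁, ← J.map_comp, reassoc_of% hr, hr, hr₂, J.map_comp, reassoc_of% hb]

lemma coneHom_split (α : ConnectionFamily A) (β : ConnectionFamily B) (f : A ⟶ B) (i : ℤ) :
    coneHom α β f i ≫ (jetProjection n X).app ((mappingCone f).X i) = 𝟙 _ := by
  simp only [coneHom, Preadditive.add_comp, Category.assoc, (jetProjection n X).naturality]
  rw [reassoc_of% (α.conn (i + 1)).split, reassoc_of% (β.conn i).split]
  exact mappingCone.id_X f i (i + 1) rfl

lemma coneHom_compat (α : ConnectionFamily A) (β : ConnectionFamily B) (f : A ⟶ B)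
    (hf : ∀ i, (α.conn i).Horizontal (β.conn i) (f.f i)) (i j : ℤ) :
    coneHom α β f i ≫ (jetFunctor n X).map ((mappingCone f).d i j) =
      (mappingCone f).d i j ≫ coneHom α β f j := by
  by_cases hij : i + 1 = j
  · subst hij
    have h := cone_aux (jetFunctor n X) (inl_coneHom α β f i) (inl_coneHom α β f (i + 1))
      (inr_coneHom α β f i) (inr_coneHom α β f (i + 1)) (α.compat (i + 1) (i + 1 + 1))
      (β.compat i (i + 1)) (hf (i + 1))
      (mappingCone.inl_v_d f (i + 1) i (i + 1 + 1) (by lia) (by lia))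
      (mappingCone.inr_f_d f i (i + 1))
    exact mappingCone.ext_from f (i + 1) i rfl h.1 h.2
  · have h : (mappingCone f).d i j = 0 := (mappingCone f).shape i j hij
    rw [h, Functor.map_zero, Limits.comp_zero, Limits.zero_comp]

/-- The family of connections `∇(a, b) = (α a, β b)` on the mapping cone of `f`. -/
def cone (α : ConnectionFamily A) (β : ConnectionFamily B) (f : A ⟶ B)
    (hf : ∀ i, (α.conn i).Horizontal (β.conn i) (f.f i)) :
    ConnectionFamily (mappingCone f) where
  conn i := ⟨coneHom α β f i, coneHom_split α β f i⟩
  compat := coneHom_compat α β f hf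

end ConnectionFamily

/-! ## Coherent sheaves, their fibres and singular sets -/

/-- The value `s(x)` of the section `s` in the fibre `F_x / 𝔪_x F_x` is zero. -/
def VanishesAt {F : PMod n X} {U : Opens X} (s : Sec F U) (x : X) : Prop :=
  ∃ (V : Opens X) (hV : V ≤ U) (hx : x ∈ V) (m : ℕ) (f : Fin m → Hol n V) (t : Fin m → Sec F V),
    (∀ a, f a ⟨x, hx⟩ = 0) ∧ Sec.res hV s = ∑ a, f a • t a

/-- `F` is free of finite rank in a neighbourhood of `x`. -/
def LocallyFreeAt (F : PMod n X) (x : X) : Prop :=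
  ∃ (U : Opens X) (_ : x ∈ U) (r : ℕ) (e : Fin r → Sec F U),
    ∀ (V : Opens X) (hV : V ≤ U) (t : Sec F V),
      ∃! f : Fin r → Hol n V, t = ∑ a, f a • Sec.res hV (e a)

/-- The set of points at which `F` is not locally free. -/
def singularSet (F : PMod n X) : Set X := {x | ¬ LocallyFreeAt F x}

/-- `F` is locally generated by finitely many sections. -/
def IsFiniteType (F : PMod n X) : Prop :=
  ∀ x : X, ∃ (U : Opens X) (_ : x ∈ U) (m : ℕ) (e : Fin m → Sec F U),
    ∀ (V : Opens X) (hV : V ≤ U) (t : Sec F V), ∀ y ∈ V,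
      ∃ (W : Opens X) (hW : W ≤ V) (_ : y ∈ W) (f : Fin m → Hol n W),
        Sec.res hW t = ∑ a, f a • Sec.res (hW.trans hV) (e a)

/-- The sheaf of relations between the sections `e` is of finite type. -/
def RelationsFiniteType (F : PMod n X) {U : Opens X} {m : ℕ} (e : Fin m → Sec F U) : Prop :=
  ∀ x ∈ U, ∃ (V : Opens X) (hV : V ≤ U) (_ : x ∈ V) (k : ℕ) (ρ : Fin k → Fin m → Hol n V),
    (∀ b, ∑ a, ρ b a • Sec.res hV (e a) = 0) ∧
    ∀ (W : Opens X) (hW : W ≤ V) (f : Fin m → Hol n W),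
      ∑ a, f a • Sec.res (hW.trans hV) (e a) = 0 → ∀ y ∈ W,
        ∃ (W' : Opens X) (hW' : W' ≤ W) (_ : y ∈ W') (c : Fin k → Hol n W'),
          ∀ a, Hol.res hW' (f a) = ∑ b, c b * Hol.res (hW'.trans hW) (ρ b a)

/-- Coherent `𝒪_X`-modules. -/
def IsCoherent (F : PMod n X) : Prop :=
  IsFiniteType F ∧ ∀ (U : Opens X) (m : ℕ) (e : Fin m → Sec F U), RelationsFiniteType F e

/-- Bounded complexes of coherent sheaves. -/
structure IsBrane (K : CochainComplex (OMod n X) ℤ) : Prop where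
  bounded : ∃ a b : ℤ, ∀ i, i < a ∨ b < i → Limits.IsZero (K.X i)
  coherent : ∀ i, IsCoherent (K.X i).val

/-! ## Values of vector fields and real derivatives -/
section
variable [IsManifold 𝓘(ℂ, Cn n) ω X]

/-- The domain of the preferred chart at `c`. -/
def chartDomain (n : ℕ) {X : Type} [TopologicalSpace X] [ChartedSpace (Cn n) X] (c : X) : Opens X :=
  ⟨(chartAt (Cn n) c).source, (chartAt (Cn n) c).open_source⟩

/-- The `j`-th coordinate function of the preferred chart at `c`. -/
def coordinate (c : X) (j : Fin n) : Hol n (chartDomain n c) :=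
  ⟨fun y => chartAt (Cn n) c y j, by
    have h : ContMDiffOn 𝓘(ℂ, Cn n) 𝓘(ℂ, Cn n) ∞ (chartAt (Cn n) c) (chartAt (Cn n) c).source :=
      contMDiffOn_chart.of_le (by exact_mod_cast le_top)
    have h1 : ContMDiff 𝓘(ℂ, Cn n) 𝓘(ℂ, Cn n) ∞
        (fun y : chartDomain n c => chartAt (Cn n) c y) :=
      h.comp_contMDiff contMDiff_subtype_val fun y => y.2
    have h2 : ContMDiff 𝓘(ℂ, Cn n) 𝓘(ℂ, ℂ) ∞ (EuclideanSpace.proj j : Cn n →L[ℂ] ℂ) :=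
      (EuclideanSpace.proj j : Cn n →L[ℂ] ℂ).contMDiff
    exact h2.comp h1⟩

/-- The `j`-th component at `x` of a vector field in the preferred chart at `c`. -/
def VecField.component {U : Opens X} (D : VecField n U) (c : X) (j : Fin n)
    (x : X) (hU : x ∈ U) (hc : x ∈ chartDomain n c) : ℂ :=
  D.app (inf_le_left : U ⊓ chartDomain n c ≤ U) (Hol.res inf_le_right (coordinate c j)) ⟨x, hU, hc⟩

/-- The value of a holomorphic vector field at `x`, in the coordinates in which Mathlib writes the
tangent space at `x`. As a real tangent vector it is `ξ = D + D̄`. -/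
def VecField.value {U : Opens X} (D : VecField n U) (x : X) (hx : x ∈ U) : Cn n :=
  WithLp.toLp 2 fun j => D.component x j x hx (mem_chart_source (Cn n) x)

/-- The derivative at `x` of the complex-valued function `φ` along the real tangent vector `ξ`. -/
def realDeriv (φ : X → ℂ) (x : X) (ξ : Cn n) : ℂ :=
  mfderiv 𝓘(ℝ, Cn n) 𝓘(ℝ, ℂ) φ x (ξ : TangentSpace 𝓘(ℝ, Cn n) x)

/-- The derivative of `φ` along the `(1,0)`-vector `D = (ξ - i J ξ) / 2`, where `ξ` is the real
tangent vector of `D` and `J` is multiplication by `i`. -/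
def VecField.wirtinger {U : Opens X} (D : VecField n U) (φ : X → ℂ) (x : X) (hx : x ∈ U) : ℂ :=
  (realDeriv φ x (D.value x hx) -
    Complex.I * realDeriv φ x (Complex.I • D.value x hx)) / 2

/-! ## Hermitian metrics and Kähler metrics -/

/-- A pairing of sections of `F` with values in complex functions. The number `h U s t x` stands for
`⟨s(x), t(x)⟩`; it has no meaning for `x` outside `U`. -/
abbrev Pairing (F : PMod n X) : Type := ∀ U : Opens X, Sec F U → Sec F U → X → ℂ

/-- `h` is a Hermitian metric on the sheaf `F`: a Hermitian inner product on every fibre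
`F_x / 𝔪_x F_x` such that the product of two sections is locally bounded, and smooth outside the
singular set. By `definite` the product depends only on the values in the fibre. -/
structure IsHermitianMetric {F : PMod n X} (h : Pairing F) : Prop where
  res : ∀ (U V : Opens X) (hV : V ≤ U) (s t : Sec F U), ∀ x ∈ V,
    h V (Sec.res hV s) (Sec.res hV t) x = h U s t x
  add_left : ∀ (U : Opens X) (s s' t : Sec F U), ∀ x ∈ U, h U (s + s') t x = h U s t x + h U s' t x
  smul_left : ∀ (U : Opens X) (f : Hol n U) (s t : Sec F U) (x : X) (hx : x ∈ U),
    h U (f • s) t x = f ⟨x, hx⟩ * h U s t x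
  conj_symm : ∀ (U : Opens X) (s t : Sec F U), ∀ x ∈ U, h U t s x = (starRingEnd ℂ) (h U s t x)
  nonneg : ∀ (U : Opens X) (s : Sec F U), ∀ x ∈ U, 0 ≤ (h U s s x).re
  definite : ∀ (U : Opens X) (s : Sec F U), ∀ x ∈ U, h U s s x = 0 ↔ VanishesAt s x
  locally_bounded : ∀ (U : Opens X) (s t : Sec F U), ∀ x ∈ U, ∃ (V : Opens X) (_ : x ∈ V) (M : ℝ),
    ∀ y ∈ V ⊓ U, ‖h U s t y‖ ≤ M
  smooth : ∀ (U : Opens X) (s t : Sec F U),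
    ContMDiffOn 𝓘(ℝ, Cn n) 𝓘(ℝ, ℂ) ∞ (h U s t) (U \ singularSet F)

/-- The connection is compatible with the metric: `d⟨s, t⟩ = ⟨∇ s, t⟩ + ⟨s, ∇ t⟩` along the real
tangent vectors, outside the singular set. -/
def HolConnection.MetricCompatible {F : OMod n X} (c : HolConnection F) (h : Pairing F.val) : Prop :=
  ∀ (U : Opens X) (D : VecField n U) (s t : Sec F.val U) (x : X) (hx : x ∈ U), x ∉ singularSet F.val →
    realDeriv (h U s t) x (D.value x hx) = h U (c.cov D s) t x + h U s (c.cov D t) x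

/-- `g` is a Kähler metric: a Hermitian metric on the holomorphic tangent bundle with closed Kähler
form, that is `D g(E, G) - E g(D, G) = g([D, E], G)` for holomorphic `D`, `E`, `G`; in coordinates
`∂_j g_{k l̄} = ∂_k g_{j l̄}`. -/
structure IsKahler (g : Pairing (tangentPresheaf n X)) : Prop where
  metric : IsHermitianMetric g
  closed : ∀ (U : Opens X) (D E G : VecField n U) (x : X) (hx : x ∈ U),
    D.wirtinger (g U E G) x hx - E.wirtinger (g U D G) x hx = g U (VecField.bracket D E) G x

/-! ## The norm of the curvature and the Yang-Mills functional -/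

/-- The constant function `z`. -/
def constHol (U : Opens X) (z : ℂ) : Hol n U := ContMDiffMap.const z

/-- Sections near `x` whose values at `x` are an orthonormal basis of the fibre `F_x / 𝔪_x F_x`. -/
structure UnitaryFrame {F : PMod n X} (h : Pairing F) (x : X) (r : ℕ) where
  dom : Opens X
  mem : x ∈ dom
  vec : Fin r → Sec F dom
  orthonormal : ∀ a b, h dom (vec a) (vec b) x = if a = b then 1 else 0
  spanning : ∀ (V : Opens X) (hV : V ≤ dom), x ∈ V → ∀ t : Sec F V, ∃ z : Fin r → ℂ,
    VanishesAt (t - ∑ a, constHol (n := n) V (z a) • Sec.res hV (vec a)) x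

/-- The number `∑_{j<k} ½ tr (K(e_j, e_k) K(e_j, e_k)*)` at `x`, for a unitary frame `e` of the tangent
space and a unitary frame `s` of the fibre of `F`. -/
def curvatureDensityOn {F : OMod n X} (g : Pairing (tangentPresheaf n X)) (h : Pairing F.val)
    (c : HolConnection F) {x : X} (e : UnitaryFrame g x n) {r : ℕ} (s : UnitaryFrame h x r) : ℝ :=
  let W : Opens X := e.dom ⊓ s.dom
  let e' : Fin n → VecField n W := fun j => VecField.res (V := W) inf_le_left (e.vec j)
  let K : Fin n → Fin n → Fin r → Sec F.val W := fun j k a =>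
    c.curvature (e' j) (e' k) (Sec.res inf_le_right (s.vec a))
  ∑ j, ∑ k ∈ Finset.Ioi j, (1 / 2) * ∑ a, (h W (K j k a) (K j k a) x).re

/-- The function `⟨K, K⟩ = ½ ∑_{j<k} tr (K(e_j, e_k) K(e_j, e_k)*)`. The value does not depend on the
unitary frames; the supremum is over a constant family. -/
def curvatureDensity {F : OMod n X} (g : Pairing (tangentPresheaf n X)) (h : Pairing F.val)
    (c : HolConnection F) (x : X) : ℝ :=
  ⨆ (p : UnitaryFrame g x n × Σ r, UnitaryFrame h x r), curvatureDensityOn g h c p.1 p.2.2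

open Classical in
/-- The density of the Riemannian volume of `g` with respect to Lebesgue measure, at a point `x` of the
chart at `c`: if `M` is the matrix of a unitary frame in the coordinates, it is `|det M|⁻²`, and
so the determinant of the matrix of `g`. The supremum is over a constant family. -/
def volumeDensity (g : Pairing (tangentPresheaf n X)) (c : X) (x : X) : ENNReal :=
  ⨆ (e : UnitaryFrame g x n), if hx : x ∈ chartDomain n c then
    ENNReal.ofReal ((‖(Matrix.of fun j k : Fin n =>
      VecField.component (e.vec k) c j x e.mem hx).det‖ ^ 2)⁻¹) else 0

/-- The Riemannian volume measure of `g`. On the domain of each chart it is the Lebesgue measure of the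
chart weighted by the volume density; these measures agree on overlaps and the supremum glues them. -/
def volumeMeasure [MeasurableSpace X] (g : Pairing (tangentPresheaf n X)) : Measure X :=
  ⨆ c : X, Measure.map (chartAt (Cn n) c).symm
    (((volume : Measure (Cn n)).restrict (chartAt (Cn n) c).target).withDensity
      fun z => volumeDensity g c ((chartAt (Cn n) c).symm z))

/-- The function `⟨K, K⟩` is integrable outside the singular set. -/
def FiniteCurvature [MeasurableSpace X] {F : OMod n X} (g : Pairing (tangentPresheaf n X))
    (h : Pairing F.val) (c : HolConnection F) : Prop :=
  IntegrableOn (curvatureDensity g h c) (singularSet F.val)ᶜ (volumeMeasure g)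

/-- `‖K‖² = ∫ ⟨K, K⟩ dvol`, over the complement of the singular set. -/
def curvatureNormSq [MeasurableSpace X] {F : OMod n X} (g : Pairing (tangentPresheaf n X))
    (h : Pairing F.val) (c : HolConnection F) : ℝ :=
  ∫ x in (singularSet F.val)ᶜ, curvatureDensity g h c x ∂(volumeMeasure g)

/-- The alternating sum `∑ᵢ (-1)ⁱ ‖K_{γⁱ}‖²` over the terms of a complex. -/
def ConnectionFamily.eulerNormSq [MeasurableSpace X] {K : CochainComplex (OMod n X) ℤ}
    (γ : ConnectionFamily K) (g : Pairing (tangentPresheaf n X))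
    (h : ∀ i, Pairing (K.X i).val) : ℝ :=
  ∑ᶠ i : ℤ, (-1 : ℝ) ^ i * curvatureNormSq g (h i) (γ.conn i)

/-- The Yang-Mills functional `YM(ψ) = ∑ᵢ (-1)ⁱ ‖K_{ϑⁱ}‖²`, where `ϑⁱ` is the connection induced by
`ψ` on the `i`-th cohomology sheaf, which carries the Hermitian metric `h i`. -/
def GaugeField.yangMills [HasDerivedCategory (OMod n X)] [MeasurableSpace X]
    {K : CochainComplex (OMod n X) ℤ} (ψ : GaugeField K) (g : Pairing (tangentPresheaf n X))
    (h : ∀ i, Pairing (K.homology i).val) : ℝ :=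
  ∑ᶠ i : ℤ, (-1 : ℝ) ^ i * curvatureNormSq g (h i) (ψ.onCohomology i)

/-! ## The metric on the mapping cone -/

open CochainComplex

/-- The projection `Cⁱ = Aⁱ⁺¹ ⊕ Bⁱ ⟶ Aⁱ⁺¹`. -/
def coneFst {A B : CochainComplex (OMod n X) ℤ} (f : A ⟶ B) (i : ℤ) :
    (mappingCone f).X i ⟶ A.X (i + 1) := (mappingCone.fst f).1.v i (i + 1) rfl

/-- The projection `Cⁱ = Aⁱ⁺¹ ⊕ Bⁱ ⟶ Bⁱ`. -/
def coneSnd {A B : CochainComplex (OMod n X) ℤ} (f : A ⟶ B) (i : ℤ) :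
    (mappingCone f).X i ⟶ B.X i := (mappingCone.snd f).v i i (add_zero i)

/-- The metric `⟨(a₁, b₁), (a₂, b₂)⟩ = ⟨a₁, a₂⟩ + ⟨b₁, b₂⟩` on `Cⁱ`. -/
def coneMetric {A B : CochainComplex (OMod n X) ℤ} (f : A ⟶ B)
    (hA : ∀ i, Pairing (A.X i).val) (hB : ∀ i, Pairing (B.X i).val) (i : ℤ) :
    Pairing ((mappingCone f).X i).val := fun U c c' x =>
  hA (i + 1) U (Sec.map (coneFst f i).val U c) (Sec.map (coneFst f i).val U c') x +
    hB i U (Sec.map (coneSnd f i).val U c) (Sec.map (coneSnd f i).val U c') x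

/-- The family `γ` on the mapping cone is given by `γ(a, b) = (α a, β b)`. -/
def ConnectionFamily.IsDirectSum {A B : CochainComplex (OMod n X) ℤ} {f : A ⟶ B}
    (γ : ConnectionFamily (mappingCone f)) (α : ConnectionFamily A) (β : ConnectionFamily B) : Prop :=
  ∀ (i : ℤ) (U : Opens X) (D : VecField n U) (c : Sec ((mappingCone f).X i).val U),
    Sec.map (coneFst f i).val U ((γ.conn i).cov D c) =
        (α.conn (i + 1)).cov D (Sec.map (coneFst f i).val U c) ∧
      Sec.map (coneSnd f i).val U ((γ.conn i).cov D c) =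
        (β.conn i).cov D (Sec.map (coneSnd f i).val U c)
end

end HolGauge

end

open HolGauge

/-! All curvatures in the statement vanish, so both identities read `0 - 0 = 0`; the work is to show
this and to check the structure on the cone.

A coherent sheaf with a holomorphic connection is locally free (`locallyFreeAt_of_connection`). Take
a minimal system of generators `e` near `x`. In a relation `∑ f_a e_a = 0` all `f_a` vanish at `x`.
Applying `∇_D` gives another relation, with coefficients `D f_b + ∑ f_a Γ_ab`, so by induction the
`f_a` vanish at `x` to infinite order, hence near `x`. The relations are locally finitely generated,
so on one neighbourhood there are none. Thus the singular sets are empty.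

A holomorphic connection compatible with a metric is then flat
(`HolConnection.MetricCompatible.curvature_eq_zero`). Differentiating `⟨s, t⟩` twice along real
vector fields shows that `K(D, E)` is skew-Hermitian. It is also complex linear in `D`, and
replacing `D` by `iD` leaves only `K = 0`.

Flatness passes to cohomology, because the induced connection is a quotient of the restriction to
the cocycles (`ConnectionFamily.onCohomology_curvature_eq_zero`). The cone is termwise a direct sum
of sheaves, connections and metrics, so the same argument applies to it. -/

noncomputable section
namespace HolGauge

variable {n : ℕ} {X : Type} [TopologicalSpace X] [ChartedSpace (Cn n) X]

/-! ### Covariant derivatives, curvature and pairings on sections. -/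

section sections
variable {F G : PMod n X} {U V W : Opens X}

lemma Sec.res_sum {ι : Type*} (s : Finset ι) (h : V ≤ U) (t : ι → Sec F U) :
    Sec.res h (∑ a ∈ s, t a) = ∑ a ∈ s, Sec.res h (t a) := map_sum _ _ _

end sections

namespace VecField
variable {U V : Opens X}

lemma bracket_app (D E : VecField n U) (h : V ≤ U) :
    (bracket D E).app h = ⁅D.app h, E.app h⁆ := rfl

lemma res_bracket (h : V ≤ U) (D E : VecField n U) :
    res h (bracket D E) = bracket (res h D) (res h E) := rfl

lemma app_const (D : VecField n U) (h : V ≤ U) (z : ℂ) : D.app h (constHol V z) = 0 := by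
  have : (constHol V z : Hol n V) = algebraMap ℂ (Hol n V) z := rfl
  rw [this, Derivation.map_algebraMap]

lemma bracket_const_smul (z : ℂ) (D E : VecField n U) :
    bracket ((constHol U z : Hol n U) • D) E = (constHol U z : Hol n U) • bracket D E := by
  ext V hV f x
  have hc : Hol.res hV (constHol U z : Hol n U) = constHol V z := rfl
  simp [bracket_app, Derivation.commutator_apply, hc, Derivation.leibniz, app_const, mul_sub]

end VecField

namespace HolConnection
variable {F G : OMod n X} {U V W : Opens X} (c : HolConnection F)

/-- The connection as a map on sections. -/
def nabla (U : Opens X) : Sec F.val U →ₗ[Hol n U] Jet F.val U := Sec.map c.toHom.val U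

lemma nabla_fst (s : Sec F.val U) : (c.nabla U s).1 = s :=
  congrArg (fun φ : F ⟶ F => Sec.map φ.val U s) c.split

lemma nabla_res (h : V ≤ U) (s : Sec F.val U) :
    c.nabla V (Sec.res h s) = Jet.res h (c.nabla U s) :=
  Sec.map_res c.toHom.val h s

lemma cov_def (D : VecField n U) (s : Sec F.val U) :
    c.cov D s = OneForm.app (c.nabla U s).2 le_rfl D := rfl

lemma cov_smul_left (f : Hol n U) (D : VecField n U) (s : Sec F.val U) :
    c.cov (f • D) s = f • c.cov D s := map_smul _ _ _

lemma cov_add (D : VecField n U) (s t : Sec F.val U) :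
    c.cov D (s + t) = c.cov D s + c.cov D t := by
  rw [cov_def, map_add]; rfl

/-- The term `df ⊗ s` comes from the twisted action on `J¹`: this is `𝒪_X`-linearity of the section,
read in the second component. -/
lemma cov_leibniz (D : VecField n U) (f : Hol n U) (s : Sec F.val U) :
    c.cov D (f • s) = f • c.cov D s + D.app le_rfl f • s := by
  rw [cov_def, map_smul, Jet.smul_snd, OneForm.app_add, LinearMap.add_apply, OneForm.dTensor_app,
    nabla_fst]
  simp [cov_def]

/-- The covariant derivative along `D` as an additive map. -/
def covHom (D : VecField n U) : Sec F.val U →+ Sec F.val U :=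
  AddMonoidHom.mk' (c.cov D) (c.cov_add D)

lemma cov_sum {ι : Type*} (u : Finset ι) (D : VecField n U) (s : ι → Sec F.val U) :
    c.cov D (∑ a ∈ u, s a) = ∑ a ∈ u, c.cov D (s a) := map_sum (c.covHom D) _ _

lemma cov_zero (D : VecField n U) : c.cov D 0 = 0 := map_zero (c.covHom D)

/-- `cov` evaluates the form `∇ s` only on fields over all of `U`. This recovers its values on
fields over smaller open sets, which need not extend to `U`. -/
lemma app_nabla (h : V ≤ U) (D : VecField n V) (s : Sec F.val U) :
    OneForm.app (c.nabla U s).2 h D = c.cov D (Sec.res h s) := by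
  rw [cov_def, nabla_res]; rfl

lemma cov_res (h : V ≤ U) (D : VecField n U) (s : Sec F.val U) :
    c.cov (VecField.res h D) (Sec.res h s) = Sec.res h (c.cov D s) := by
  rw [← app_nabla, cov_def, ← OneForm.app_res]

lemma curvature_res (h : V ≤ U) (D E : VecField n U) (s : Sec F.val U) :
    c.curvature (VecField.res h D) (VecField.res h E) (Sec.res h s) =
      Sec.res h (c.curvature D E s) := by
  simp only [curvature, map_sub, ← VecField.res_bracket, cov_res]

/-- Derivations kill constants, so no Leibniz terms arise. The case `z = i` is what forces a
skew-Hermitian curvature to vanish. -/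
lemma curvature_const_smul_left (z : ℂ) (D E : VecField n U) (s : Sec F.val U) :
    c.curvature ((constHol U z : Hol n U) • D) E s = (constHol U z : Hol n U) • c.curvature D E s := by
  simp only [curvature, cov_smul_left, cov_leibniz, VecField.app_const, zero_smul, add_zero,
    VecField.bracket_const_smul, smul_sub]

variable {c} {c' : HolConnection G}

lemma Horizontal.cov {φ : F ⟶ G} (h : c.Horizontal c' φ) (D : VecField n U) (s : Sec F.val U) :
    Sec.map φ.val U (c.cov D s) = c'.cov D (Sec.map φ.val U s) :=
  congrArg (fun ψ : F ⟶ (jetFunctor n X).obj G =>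
    OneForm.app (Prod.snd (Sec.map ψ.val U s : Jet G.val U)) le_rfl D) h

/-- Naturality of the curvature is what carries flatness to subsheaves and quotients. -/
lemma Horizontal.curvature {φ : F ⟶ G} (h : c.Horizontal c' φ) (D E : VecField n U)
    (s : Sec F.val U) :
    Sec.map φ.val U (c.curvature D E s) = c'.curvature D E (Sec.map φ.val U s) := by
  simp only [HolConnection.curvature, map_sub, h.cov]

lemma hom_ext_sections {φ ψ : F ⟶ G} (h : ∀ (U : Opens X) s, Sec.map φ.val U s = Sec.map ψ.val U s) :
    φ = ψ := by
  ext U s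
  exact h U.unop s

lemma ext_cov {c c' : HolConnection F}
    (h : ∀ (U : Opens X) (D : VecField n U) (s : Sec F.val U), c.cov D s = c'.cov D s) : c = c' := by
  have : c.toHom = c'.toHom := by
    refine hom_ext_sections fun U s => ?_
    refine Jet.ext ?_ ?_
    · exact (c.nabla_fst s).trans (c'.nabla_fst s).symm
    · refine OneForm.ext fun V hV D => ?_
      exact (c.app_nabla hV D s).trans ((h V D _).trans (c'.app_nabla hV D s).symm)
  cases c; cases c'; congr

end HolConnection

namespace IsHermitianMetric
variable {F : PMod n X} {h : Pairing F} (H : IsHermitianMetric h) {U V : Opens X} {x : X}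
include H

lemma zero_left (hx : x ∈ U) (t : Sec F U) : h U 0 t x = 0 := by
  simpa using H.smul_left U 0 0 t x hx

lemma smul_right (hx : x ∈ U) (f : Hol n U) (s t : Sec F U) :
    h U s (f • t) x = (starRingEnd ℂ) (f ⟨x, hx⟩) * h U s t x := by
  rw [H.conj_symm U _ s x hx, H.smul_left U _ _ _ x hx, map_mul, ← H.conj_symm U t s x hx]

lemma neg_left (hx : x ∈ U) (s t : Sec F U) : h U (-s) t x = - h U s t x := by
  have := H.add_left U (-s) s t x hx
  rw [neg_add_cancel, H.zero_left hx] at this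
  linear_combination -this

lemma sub_left (hx : x ∈ U) (s s' t : Sec F U) : h U (s - s') t x = h U s t x - h U s' t x := by
  rw [sub_eq_add_neg, H.add_left U _ _ _ x hx, H.neg_left hx, sub_eq_add_neg]

lemma sub_right (hx : x ∈ U) (s t t' : Sec F U) : h U s (t - t') x = h U s t x - h U s t' x := by
  rw [H.conj_symm U _ s x hx, H.sub_left hx, map_sub, ← H.conj_symm U t s x hx,
    ← H.conj_symm U t' s x hx]

lemma im_self (hx : x ∈ U) (s : Sec F U) : (h U s s x).im = 0 := by
  have := congrArg Complex.im (H.conj_symm U s s x hx)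
  rw [Complex.conj_im] at this
  linarith

end IsHermitianMetric

/-! ### The terms of a mapping cone -/
section cone
open CochainComplex
variable {A B : CochainComplex (OMod n X) ℤ} (f : A ⟶ B) (i : ℤ)

/-- The inclusion `Aⁱ⁺¹ ⟶ Cⁱ`. -/
def coneInl : A.X (i + 1) ⟶ (mappingCone f).X i := (mappingCone.inl f).v (i + 1) i (by lia)

/-- The inclusion `Bⁱ ⟶ Cⁱ`. -/
def coneInr : B.X i ⟶ (mappingCone f).X i := (mappingCone.inr f).f i

lemma coneInl_coneFst : coneInl f i ≫ coneFst f i = 𝟙 _ := by simp [coneInl, coneFst]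
lemma coneInr_coneSnd : coneInr f i ≫ coneSnd f i = 𝟙 _ := by simp [coneInr, coneSnd]
lemma coneInl_coneSnd : coneInl f i ≫ coneSnd f i = 0 := by simp [coneInl, coneSnd]
lemma coneInr_coneFst : coneInr f i ≫ coneFst f i = 0 := by simp [coneInr, coneFst]
lemma cone_id : coneFst f i ≫ coneInl f i + coneSnd f i ≫ coneInr f i = 𝟙 _ :=
  mappingCone.id_X f i (i + 1) rfl

variable (α : ConnectionFamily A) (β : ConnectionFamily B)
  (hf : ∀ i, (α.conn i).Horizontal (β.conn i) (f.f i))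

/-- Composing with a projection kills the other summand of `coneHom`. Together with
`cone_horizontal_snd` this reduces computations on the cone to `α` and `β`. -/
lemma cone_horizontal_fst : ((α.cone β f hf).conn i).Horizontal (α.conn (i + 1)) (coneFst f i) := by
  simp only [HolConnection.Horizontal, ConnectionFamily.cone, ConnectionFamily.coneHom,
    Preadditive.add_comp, Category.assoc, ← Functor.map_comp]
  have h1 := coneInl_coneFst f i
  have h2 := coneInr_coneFst f i
  simp only [coneInl, coneInr] at h1 h2
  rw [h1, h2]
  simp [coneFst]

lemma cone_horizontal_snd : ((α.cone β f hf).conn i).Horizontal (β.conn i) (coneSnd f i) := by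
  simp only [HolConnection.Horizontal, ConnectionFamily.cone, ConnectionFamily.coneHom,
    Preadditive.add_comp, Category.assoc, ← Functor.map_comp]
  have h1 := coneInl_coneSnd f i
  have h2 := coneInr_coneSnd f i
  simp only [coneInl, coneInr] at h1 h2
  rw [h1, h2]
  simp [coneSnd]

end cone

end HolGauge

namespace HolGauge

variable {n : ℕ} {X : Type} [TopologicalSpace X] [ChartedSpace (Cn n) X]

/-! ### Vanishing in the fibre -/
namespace VanishesAt
variable {F G : PMod n X} {U V : Opens X} {x : X}

lemma of_fintype {ι : Type*} [Fintype ι] {s : Sec F U} (hV : V ≤ U) (hx : x ∈ V)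
    (f : ι → Hol n V) (t : ι → Sec F V) (hf : ∀ a, f a ⟨x, hx⟩ = 0)
    (hs : Sec.res hV s = ∑ a, f a • t a) : VanishesAt s x := by
  let e := (Fintype.equivFin ι).symm
  exact ⟨V, hV, hx, _, f ∘ e, t ∘ e, fun a => hf _,
    hs.trans (e.sum_comp fun a => f a • t a).symm⟩

lemma map (φ : F ⟶ G) {s : Sec F U} (h : VanishesAt s x) : VanishesAt (Sec.map φ U s) x := by
  obtain ⟨V, hV, hx, m, f, t, hf, hs⟩ := h
  refine ⟨V, hV, hx, m, f, fun a => Sec.map φ V (t a), hf, ?_⟩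
  rw [← Sec.map_res, hs, map_sum]
  simp

lemma add {s t : Sec F U} (hs : VanishesAt s x) (ht : VanishesAt t x) : VanishesAt (s + t) x := by
  obtain ⟨V, hV, hx, m, f, s', hf, hs⟩ := hs
  obtain ⟨W, hW, hx', k, g, t', hg, ht⟩ := ht
  refine of_fintype (V := V ⊓ W) (inf_le_left.trans hV) ⟨hx, hx'⟩
    (Sum.elim (fun a => Hol.res inf_le_left (f a)) (fun b => Hol.res inf_le_right (g b)))
    (Sum.elim (fun a => Sec.res inf_le_left (s' a)) (fun b => Sec.res inf_le_right (t' b))) ?_ ?_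
  · rintro (a | b)
    · exact hf a
    · exact hg b
  · rw [Fintype.sum_sum_type, map_add, ← Sec.res_res hV inf_le_left, hs,
      ← Sec.res_res hW inf_le_right t, ht]
    simp only [Sec.res_sum, Sec.res_smul, Sum.elim_inl, Sum.elim_inr]

end VanishesAt

/-! ### Direct sums -/

/-- `M` is the direct sum of `F` and `G`. -/
structure SumData (M F G : PMod n X) where
  fst : M ⟶ F
  snd : M ⟶ G
  inl : F ⟶ M
  inr : G ⟶ M
  inl_fst : inl ≫ fst = 𝟙 F
  inr_snd : inr ≫ snd = 𝟙 G
  inl_snd : inl ≫ snd = 0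
  inr_fst : inr ≫ fst = 0
  total : fst ≫ inl + snd ≫ inr = 𝟙 M

namespace SumData
variable {M F G : PMod n X} (S : SumData M F G) {U V : Opens X} {x : X}

lemma inl_fst_add_inr_snd (s : Sec M U) :
    Sec.map S.inl U (Sec.map S.fst U s) + Sec.map S.inr U (Sec.map S.snd U s) = s :=
  congrArg (fun φ : M ⟶ M => Sec.map φ U s) S.total

lemma sec_ext {s t : Sec M U} (h₁ : Sec.map S.fst U s = Sec.map S.fst U t)
    (h₂ : Sec.map S.snd U s = Sec.map S.snd U t) : s = t := by
  rw [← S.inl_fst_add_inr_snd s, h₁, h₂, S.inl_fst_add_inr_snd]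

/-- Morphisms preserve vanishing in the fibre, and a section is the sum of the images of its
components. This yields definiteness of the metric on the cone. -/
lemma vanishesAt_iff (s : Sec M U) :
    VanishesAt s x ↔ VanishesAt (Sec.map S.fst U s) x ∧ VanishesAt (Sec.map S.snd U s) x := by
  refine ⟨fun h => ⟨h.map _, h.map _⟩, fun h => ?_⟩
  rw [← S.inl_fst_add_inr_snd s]
  exact (h.1.map _).add (h.2.map _)

include S

lemma isFiniteType (hF : IsFiniteType F) (hG : IsFiniteType G) : IsFiniteType M := by
  intro x
  obtain ⟨U, hxU, m, e, he⟩ := hF x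
  obtain ⟨V, hxV, k, d, hd⟩ := hG x
  let u : Fin m ⊕ Fin k → Sec M (U ⊓ V) :=
    Sum.elim (fun a => Sec.map S.inl _ (Sec.res inf_le_left (e a)))
      (fun b => Sec.map S.inr _ (Sec.res inf_le_right (d b)))
  let ε := (Fintype.equivFin (Fin m ⊕ Fin k)).symm
  refine ⟨U ⊓ V, ⟨hxU, hxV⟩, _, u ∘ ε, fun W hW t y hy => ?_⟩
  obtain ⟨W₁, hW₁, hy₁, f, hf⟩ := he W (hW.trans inf_le_left) (Sec.map S.fst W t) y hy
  obtain ⟨W₂, hW₂, hy₂, g, hg⟩ := hd W (hW.trans inf_le_right) (Sec.map S.snd W t) y hy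
  let w : Fin m ⊕ Fin k → Hol n (W₁ ⊓ W₂) :=
    Sum.elim (fun a => Hol.res inf_le_left (f a)) (fun b => Hol.res inf_le_right (g b))
  have hw : W₁ ⊓ W₂ ≤ W := inf_le_left.trans hW₁
  refine ⟨W₁ ⊓ W₂, hw, ⟨hy₁, hy₂⟩, w ∘ ε, ?_⟩
  refine Eq.trans ?_ (ε.sum_comp fun a => w a • Sec.res (hw.trans hW) (u a)).symm
  replace hf := congrArg (Sec.res (inf_le_left : W₁ ⊓ W₂ ≤ W₁)) hf
  replace hg := congrArg (Sec.res (inf_le_right : W₁ ⊓ W₂ ≤ W₂)) hg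
  simp only [Sec.res_res, Sec.res_sum, Sec.res_smul, ← Sec.map_res] at hf hg
  rw [← S.inl_fst_add_inr_snd (Sec.res hw t), Sec.map_res, Sec.map_res, ← Sec.map_res,
    ← Sec.map_res, hf, hg, Fintype.sum_sum_type]
  simp [u, w, Sec.map_res, map_sum]

/-- A relation between the `e a` is first a relation between their `F`-components, hence a
combination `∑ c_b ρ₁_b`. It kills the `G`-components exactly when `c` is a relation between the
sections `t b`, and such relations are again finitely generated. -/
lemma relationsFiniteType (hF : ∀ (U : Opens X) (m : ℕ) (e : Fin m → Sec F U), RelationsFiniteType F e)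
    (hG : ∀ (U : Opens X) (m : ℕ) (e : Fin m → Sec G U), RelationsFiniteType G e)
    {m : ℕ} (e : Fin m → Sec M U) : RelationsFiniteType M e := by
  intro x hx
  obtain ⟨V₁, hV₁, hx₁, k₁, ρ₁, hρ₁, hgen₁⟩ := hF U m (fun a => Sec.map S.fst U (e a)) x hx
  -- The `G`-component left over by the generating relation `ρ₁ b`.
  let t : Fin k₁ → Sec G V₁ := fun b => ∑ a, ρ₁ b a • Sec.res hV₁ (Sec.map S.snd U (e a))
  obtain ⟨V₂, hV₂, hx₂, k₂, ρ₂, hρ₂, hgen₂⟩ := hG V₁ k₁ t x hx₁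
  refine ⟨V₂, hV₂.trans hV₁, hx₂, k₂, fun c a => ∑ b, ρ₂ c b * Hol.res hV₂ (ρ₁ b a), ?_, ?_⟩
  · have key : ∀ (N : PMod n X) (u : Fin m → Sec N U) (c : Fin k₂),
        ∑ a, (∑ b, ρ₂ c b * Hol.res hV₂ (ρ₁ b a)) • Sec.res (hV₂.trans hV₁) (u a) =
          ∑ b, ρ₂ c b • Sec.res hV₂ (∑ a, ρ₁ b a • Sec.res hV₁ (u a)) := by
      intro N u c
      simp only [Sec.res_sum, Sec.res_smul, Sec.res_res, Finset.sum_smul, Finset.smul_sum, mul_smul]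
      exact Finset.sum_comm
    intro c
    refine S.sec_ext ?_ ?_
    · rw [map_sum, map_zero]
      simp only [map_smul, Sec.map_res]
      rw [key]
      simp [hρ₁]
    · rw [map_sum, map_zero]
      simp only [map_smul, Sec.map_res]
      rw [key]
      exact hρ₂ c
  · intro W hW f hf y hy
    have hf₁ := congrArg (Sec.map S.fst W) hf
    have hf₂ := congrArg (Sec.map S.snd W) hf
    simp only [map_sum, map_smul, Sec.map_res, map_zero] at hf₁ hf₂
    obtain ⟨W', hW', hy', c, hc⟩ := hgen₁ W (hW.trans hV₂) f hf₁ y hy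
    have hct : ∑ b, c b • Sec.res ((hW'.trans hW).trans hV₂) (t b) = 0 := by
      replace hf₂ := congrArg (Sec.res hW') hf₂
      simp only [Sec.res_sum, Sec.res_smul, Sec.res_res, hc, map_zero, Finset.sum_smul,
        mul_smul] at hf₂
      rw [Finset.sum_comm] at hf₂
      simp only [t, Sec.res_sum, Sec.res_smul, Sec.res_res, Finset.smul_sum]
      exact hf₂
    obtain ⟨W'', hW'', hy'', d, hd⟩ := hgen₂ W' (hW'.trans hW) c hct y hy'
    refine ⟨W'', hW''.trans hW', hy'', d, fun a => ?_⟩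
    rw [← Hol.res_res hW' hW'', hc a, map_sum]
    simp only [map_mul, hd, map_sum, Hol.res_res, Finset.sum_mul, Finset.mul_sum, mul_assoc]
    exact Finset.sum_comm

lemma isCoherent (hF : IsCoherent F) (hG : IsCoherent G) : IsCoherent M :=
  ⟨S.isFiniteType hF.1 hG.1, fun _ _ e => S.relationsFiniteType hF.2 hG.2 e⟩

end SumData

/-! ### Coherence of the cone and uniqueness of its connection. -/

section cone
open CochainComplex
variable {A B : CochainComplex (OMod n X) ℤ} (f : A ⟶ B) (i : ℤ)

/-- The term `Cⁱ` of the mapping cone as a direct sum. -/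
def coneSum : SumData ((mappingCone f).X i).val (A.X (i + 1)).val (B.X i).val where
  fst := (coneFst f i).val
  snd := (coneSnd f i).val
  inl := (coneInl f i).val
  inr := (coneInr f i).val
  inl_fst := congrArg SheafOfModules.Hom.val (coneInl_coneFst f i)
  inr_snd := congrArg SheafOfModules.Hom.val (coneInr_coneSnd f i)
  inl_snd := congrArg SheafOfModules.Hom.val (coneInl_coneSnd f i)
  inr_fst := congrArg SheafOfModules.Hom.val (coneInr_coneFst f i)
  total := congrArg SheafOfModules.Hom.val (cone_id f i)

variable {f}

lemma IsBrane.mappingCone (hA : IsBrane A) (hB : IsBrane B) : IsBrane (mappingCone f) where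
  bounded := by
    obtain ⟨a, b, hab⟩ := hA.bounded
    obtain ⟨c, d, hcd⟩ := hB.bounded
    -- The shift by one is due to `Aⁱ⁺¹` in degree `i`.
    refine ⟨min (a - 1) c, max b d, fun i hi => ?_⟩
    have h1 : Limits.IsZero (A.X (i + 1)) := hab _ (by omega)
    have h2 : Limits.IsZero (B.X i) := hcd _ (by omega)
    rw [Limits.IsZero.iff_id_eq_zero, ← cone_id f i, h1.eq_of_tgt (coneFst f i) 0,
      h2.eq_of_tgt (coneSnd f i) 0]
    simp
  coherent i := (coneSum f i).isCoherent (hA.coherent _) (hB.coherent _)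

variable (α : ConnectionFamily A) (β : ConnectionFamily B)
  (hf : ∀ i, (α.conn i).Horizontal (β.conn i) (f.f i))

lemma ConnectionFamily.ext_conn {K : CochainComplex (OMod n X) ℤ} {γ γ' : ConnectionFamily K}
    (h : ∀ i, γ.conn i = γ'.conn i) : γ = γ' := by
  cases γ; cases γ'; congr; exact funext h

/-- The two projections are jointly injective on sections, so the two equations fix every `∇_D c`,
and a connection is determined by its covariant derivatives. -/
lemma cone_isDirectSum_iff (γ : ConnectionFamily (CochainComplex.mappingCone f)) :
    γ.IsDirectSum α β ↔ γ = α.cone β f hf := by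
  have key : (α.cone β f hf).IsDirectSum α β := fun i U D c =>
    ⟨(cone_horizontal_fst f i α β hf).cov D c, (cone_horizontal_snd f i α β hf).cov D c⟩
  refine ⟨fun h => ConnectionFamily.ext_conn fun i => HolConnection.ext_cov fun U D s => ?_,
    fun h => h ▸ key⟩
  exact (coneSum f i).sec_ext ((h i U D s).1.trans (key i U D s).1.symm)
    ((h i U D s).2.trans (key i U D s).2.symm)

end cone
end HolGauge

namespace HolGauge

variable {n : ℕ} {X : Type} [TopologicalSpace X] [ChartedSpace (Cn n) X]

/-! ### Holomorphic functions in charts -/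
namespace Hol
variable {U V W : Opens X} {x : X}

open Classical in
/-- The extension by zero of a holomorphic function. -/
def ext (f : Hol n V) : X → ℂ := fun y => if h : y ∈ V then f ⟨y, h⟩ else 0

lemma ext_apply (f : Hol n V) (hx : x ∈ V) : f.ext x = f ⟨x, hx⟩ := dif_pos hx

lemma contMDiffAt_ext (f : Hol n V) (hx : x ∈ V) :
    ContMDiffAt 𝓘(ℂ, Cn n) 𝓘(ℂ, ℂ) ∞ f.ext x := by
  have h : ContMDiffAt 𝓘(ℂ, Cn n) 𝓘(ℂ, ℂ) ∞ (fun y : V => f.ext y) ⟨x, hx⟩ := by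
    have : (fun y : V => f.ext y) = f := funext fun y => f.ext_apply y.2
    rw [this]
    exact f.contMDiff _
  exact contMDiffAt_subtype_iff.1 h

/-- A function on `X` that is holomorphic at all points of `V`, as a holomorphic function on `V`. -/
def ofFun (V : Opens X) (g : X → ℂ)
    (hg : ∀ y ∈ V, ContMDiffAt 𝓘(ℂ, Cn n) 𝓘(ℂ, ℂ) ∞ g y) : Hol n V :=
  ⟨fun y => g y, fun y => contMDiffAt_subtype_iff.2 (hg y y.2)⟩

variable (c : X)

/-- A holomorphic function in the preferred chart at `c`. -/
def read (f : Hol n V) : Cn n → ℂ := fun z => f.ext ((chartAt (Cn n) c).symm z)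

lemma read_apply (f : Hol n V) (hx : x ∈ V) (hc : x ∈ chartDomain n c) :
    f.read c (chartAt (Cn n) c x) = f ⟨x, hx⟩ := by
  rw [read, (chartAt (Cn n) c).left_inv hc, ext_apply]

lemma eventually_nhds_chart {p : X → Prop} (hc : x ∈ chartDomain n c) (h : ∀ᶠ y in nhds x, p y) :
    ∀ᶠ z in nhds (chartAt (Cn n) c x), p ((chartAt (Cn n) c).symm z) := by
  have := (chartAt (Cn n) c).continuousAt_symm ((chartAt (Cn n) c).map_source hc)
  rw [ContinuousAt, (chartAt (Cn n) c).left_inv hc] at this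
  exact this.eventually h

/-- Since `read` extends by zero, identities in a chart hold only near points of `V`. Equality of
germs is enough to differentiate. -/
lemma read_eventually_eq {f : Hol n V} {g : Cn n → ℂ} (hx : x ∈ V) (hc : x ∈ chartDomain n c)
    (h : ∀ y (hy : y ∈ V), y ∈ chartDomain n c → f ⟨y, hy⟩ = g (chartAt (Cn n) c y)) :
    f.read c =ᶠ[nhds (chartAt (Cn n) c x)] g := by
  have h1 := eventually_nhds_chart c hc
    ((show ∀ᶠ y in nhds x, y ∈ V from V.isOpen.mem_nhds hx).and
      (show ∀ᶠ y in nhds x, y ∈ chartDomain n c from (chartDomain n c).isOpen.mem_nhds hc))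
  filter_upwards [h1, (chartAt (Cn n) c).open_target.mem_nhds
    ((chartAt (Cn n) c).map_source hc)] with z hz hz'
  rw [read, ext_apply _ hz.1, h _ hz.1 hz.2, (chartAt (Cn n) c).right_inv hz']

variable [IsManifold 𝓘(ℂ, Cn n) ω X]

lemma contDiffAt_read (f : Hol n V) (hx : x ∈ V) (hc : x ∈ chartDomain n c) :
    ContDiffAt ℂ ∞ (f.read c) (chartAt (Cn n) c x) := by
  have h1 : ContMDiffAt 𝓘(ℂ, Cn n) 𝓘(ℂ, Cn n) ∞ (chartAt (Cn n) c).symm (chartAt (Cn n) c x) :=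
    ((contMDiffOn_chart_symm (n := ω)).of_le (by exact_mod_cast le_top)).contMDiffAt
      ((chartAt (Cn n) c).open_target.mem_nhds ((chartAt (Cn n) c).map_source hc))
  have h2 := f.contMDiffAt_ext hx
  rw [← (chartAt (Cn n) c).left_inv hc] at h2
  exact contMDiffAt_iff_contDiffAt.1 (h2.comp _ h1)

lemma contMDiffAt_chart (hc : x ∈ chartDomain n c) :
    ContMDiffAt 𝓘(ℂ, Cn n) 𝓘(ℂ, Cn n) ∞ (chartAt (Cn n) c) x :=
  ((contMDiffOn_chart (n := ω)).of_le (by exact_mod_cast le_top)).contMDiffAt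
    ((chartAt (Cn n) c).open_source.mem_nhds hc)

/-- The partial derivative of `f` along the constant vector `v` in the preferred chart at `c`. -/
def partialDeriv (hV : V ≤ chartDomain n c) (v : Cn n) (f : Hol n V) : Hol n V :=
  ofFun V (fun y => fderiv ℂ (f.read c) (chartAt (Cn n) c y) v) fun y hy => by
    have h1 : ContDiffAt ℂ ∞ (fun z => fderiv ℂ (f.read c) z v) (chartAt (Cn n) c y) :=
      ((f.contDiffAt_read c hy (hV hy)).fderiv_right (m := ∞) le_rfl).clm_apply contDiffAt_const
    exact (contMDiffAt_iff_contDiffAt.2 h1).comp y (contMDiffAt_chart c (hV hy))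

lemma partialDeriv_apply (hV : V ≤ chartDomain n c) (v : Cn n) (f : Hol n V) (y : V) :
    partialDeriv c hV v f y = fderiv ℂ (f.read c) (chartAt (Cn n) c y) v := rfl

lemma differentiableAt_read (f : Hol n V) (hx : x ∈ V) (hc : x ∈ chartDomain n c) :
    DifferentiableAt ℂ (f.read c) (chartAt (Cn n) c x) :=
  (f.contDiffAt_read c hx hc).differentiableAt (by simp)

/-- The partial derivative along a constant vector as a derivation. -/
def partialDerivation (hV : V ≤ chartDomain n c) (v : Cn n) : Derivation ℂ (Hol n V) (Hol n V) :=
  Derivation.mk'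
    { toFun := partialDeriv c hV v
      map_add' := fun f g => by
        ext y
        have h := read_eventually_eq (f := f + g) (g := f.read c + g.read c) c y.2 (hV y.2)
          fun y hy hc => by simp [read_apply c _ hy hc]
        change _ = partialDeriv c hV v f y + partialDeriv c hV v g y
        simp only [partialDeriv_apply]
        rw [h.fderiv_eq, fderiv_add (f.differentiableAt_read c y.2 (hV y.2))
          (g.differentiableAt_read c y.2 (hV y.2))]
        rfl
      map_smul' := fun a f => by
        ext y
        have h := read_eventually_eq (f := a • f) (g := a • f.read c) c y.2 (hV y.2)
          fun y hy hc => by simp [read_apply c _ hy hc]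
        change _ = a • partialDeriv c hV v f y
        simp only [partialDeriv_apply]
        rw [h.fderiv_eq, fderiv_const_smul (f.differentiableAt_read c y.2 (hV y.2))]
        rfl }
    fun f g => by
      ext y
      have h := read_eventually_eq (f := f * g) (g := f.read c * g.read c) c y.2 (hV y.2)
        fun y hy hc => by simp [read_apply c _ hy hc]
      change partialDeriv c hV v (f * g) y =
        f y * partialDeriv c hV v g y + g y * partialDeriv c hV v f y
      simp only [partialDeriv_apply]
      rw [h.fderiv_eq, fderiv_mul (f.differentiableAt_read c y.2 (hV y.2))
        (g.differentiableAt_read c y.2 (hV y.2)), read_apply c f y.2 (hV y.2),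
        read_apply c g y.2 (hV y.2)]
      rfl

end Hol

variable [IsManifold 𝓘(ℂ, Cn n) ω X]

/-- The vector field that is constant with value `v` in the preferred chart at `c`. -/
def VecField.const (c : X) (v : Cn n) : VecField n (chartDomain n c) :=
  ⟨fun V => Hol.partialDerivation c V.2 v, fun V W hV hWV f => by
    ext y
    have h := Hol.read_eventually_eq (f := Hol.res hWV f) (g := f.read c) c y.2 ((hWV.trans hV) y.2)
      fun y hy hc => by rw [Hol.read_apply c _ (hWV hy) hc]; rfl
    exact congrArg (fun L : Cn n →L[ℂ] ℂ => L v) h.fderiv_eq⟩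

lemma VecField.const_app_apply (c : X) (v : Cn n) {V : Opens X} (hV : V ≤ chartDomain n c)
    (f : Hol n V) (y : V) :
    (VecField.const c v).app hV f y = fderiv ℂ (f.read c) (chartAt (Cn n) c y) v := rfl

end HolGauge

namespace HolGauge
variable {n : ℕ} {X : Type} [TopologicalSpace X] [ChartedSpace (Cn n) X]

/-! ### Order of vanishing and the identity theorem -/

/-- All iterated derivatives of order at most `k` of `f` along holomorphic vector fields vanish
at `x`. -/
def VanishesToOrder (x : X) : ℕ → ∀ (V : Opens X), x ∈ V → Hol n V → Prop
  | 0, _, hx, f => f ⟨x, hx⟩ = 0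
  | k + 1, V, hx, f => f ⟨x, hx⟩ = 0 ∧ ∀ (W : Opens X) (hW : W ≤ V) (hxW : x ∈ W) (D : VecField n W),
      VanishesToOrder x k W hxW (D.app le_rfl (Hol.res hW f))

namespace VanishesToOrder
variable {x : X} {V W : Opens X} {k : ℕ}

lemma res {hx : x ∈ V} {f : Hol n V} (h : VanishesToOrder x k V hx f) (hW : W ≤ V) (hxW : x ∈ W) :
    VanishesToOrder x k W hxW (Hol.res hW f) := by
  cases k with
  | zero => exact h
  | succ k => exact ⟨h.1, fun W' hW' hxW' D => h.2 W' (hW'.trans hW) hxW' D⟩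

lemma of_succ {hx : x ∈ V} {f : Hol n V} (h : VanishesToOrder x (k + 1) V hx f) :
    VanishesToOrder x k V hx f := by
  induction k generalizing V with
  | zero => exact h.1
  | succ k ih => exact ⟨h.1, fun W hW hxW D => ih (h.2 W hW hxW D)⟩

lemma add {hx : x ∈ V} {f g : Hol n V} (hf : VanishesToOrder x k V hx f)
    (hg : VanishesToOrder x k V hx g) : VanishesToOrder x k V hx (f + g) := by
  induction k generalizing V with
  | zero => exact (congrArg₂ (· + ·) hf hg).trans (add_zero _)
  | succ k ih =>
    refine ⟨(congrArg₂ (· + ·) hf.1 hg.1).trans (add_zero _), fun W hW hxW D => ?_⟩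
    rw [map_add, map_add]
    exact ih (hf.2 W hW hxW D) (hg.2 W hW hxW D)

/-- In `D(gf) = g Df + f Dg` both `Df` and `f` vanish to one order less than the order assumed of
`f`. -/
lemma mul_left {hx : x ∈ V} {f : Hol n V} (hf : VanishesToOrder x k V hx f) (g : Hol n V) :
    VanishesToOrder x k V hx (g * f) := by
  induction k generalizing V with
  | zero => exact (congrArg (g ⟨x, hx⟩ * ·) hf).trans (mul_zero _)
  | succ k ih =>
    refine ⟨(congrArg (g ⟨x, hx⟩ * ·) hf.1).trans (mul_zero _), fun W hW hxW D => ?_⟩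
    rw [map_mul, Derivation.leibniz, smul_eq_mul, smul_eq_mul, mul_comm (Hol.res hW f)]
    exact (ih (hf.2 W hW hxW D) _).add (ih (hf.of_succ.res hW hxW) _)

lemma zero {hx : x ∈ V} : VanishesToOrder x k V hx (0 : Hol n V) := by
  induction k generalizing V with
  | zero => rfl
  | succ k ih =>
    refine ⟨rfl, fun W hW hxW D => ?_⟩
    rw [map_zero, map_zero]
    exact ih

lemma sum {ι : Type*} (s : Finset ι) {hx : x ∈ V} {f : ι → Hol n V}
    (hf : ∀ i ∈ s, VanishesToOrder x k V hx (f i)) : VanishesToOrder x k V hx (∑ i ∈ s, f i) :=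
  Finset.sum_induction f (VanishesToOrder x k V hx) (fun _ _ => add) zero hf

lemma neg {hx : x ∈ V} {f : Hol n V} (hf : VanishesToOrder x k V hx f) :
    VanishesToOrder x k V hx (-f) := by
  have := hf.mul_left (-1)
  rwa [neg_one_mul] at this

/-- The order of vanishing depends only on the germ. Connection coefficients exist only on smaller
neighbourhoods, so conclusions must be carried back from there. -/
lemma of_res {hx : x ∈ V} {f : Hol n V} (hW : W ≤ V) (hxW : x ∈ W)
    (h : VanishesToOrder x k W hxW (Hol.res hW f)) : VanishesToOrder x k V hx f := by
  induction k generalizing V W with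
  | zero => exact h
  | succ k ih =>
    refine ⟨h.1, fun V' hV' hxV' D => ih (W := V' ⊓ W) inf_le_left ⟨hxV', hxW⟩ ?_⟩
    have := h.2 (V' ⊓ W) inf_le_right ⟨hxV', hxW⟩ (VecField.res inf_le_left D)
    rw [Hol.res_res, VecField.app_res'] at this
    rw [← VecField.app_res D le_rfl inf_le_left]
    exact this

lemma iterate_app {hx : x ∈ V} {f : Hol n V} (h : VanishesToOrder x k V hx f) {U : Opens X}
    (D : VecField n U) (hV : V ≤ U) : ((D.app hV)^[k] f) ⟨x, hx⟩ = 0 := by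
  induction k generalizing f with
  | zero => exact h
  | succ k ih => exact ih (h.2 V le_rfl hx (VecField.res hV D))

end VanishesToOrder

variable [IsManifold 𝓘(ℂ, Cn n) ω X]

/-- A holomorphic function that vanishes to infinite order at a point vanishes nearby. -/
lemma eventually_zero_of_vanishesToOrder {x : X} {V : Opens X} (hx : x ∈ V) (f : Hol n V)
    (hf : ∀ k, VanishesToOrder x k V hx f) :
    ∃ (W : Opens X) (hW : W ≤ V) (_ : x ∈ W), Hol.res hW f = 0 := by
  let φ := chartAt (Cn n) x
  let V' : Opens X := V ⊓ chartDomain n x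
  have hxc : x ∈ chartDomain n x := mem_chart_source _ x
  have hx' : x ∈ V' := ⟨hx, hxc⟩
  have hVc : V' ≤ chartDomain n x := inf_le_right
  let f' : Hol n V' := Hol.res inf_le_left f
  have hf' : ∀ k, VanishesToOrder x k V' hx' f' := fun k => (hf k).res _ _
  obtain ⟨r, hr, hball⟩ := Metric.eventually_nhds_iff_ball.1
    ((Hol.eventually_nhds_chart x hxc (V'.isOpen.mem_nhds hx')).and
      (φ.open_target.mem_nhds (φ.map_source hxc)))
  have hpt : ∀ z ∈ Metric.ball (φ x) r, ∃ y, ∃ hy : y ∈ V', φ y = z := fun z hz =>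
    ⟨φ.symm z, (hball z hz).1, φ.right_inv (hball z hz).2⟩
  -- Restrict to the complex line `t ↦ φ x + t v`. The `k`-th derivative in `t` is the `k`-fold
  -- application of the constant field `v`, so all Taylor coefficients at `t = 0` vanish.
  have key : ∀ v : Cn n, ‖v‖ < r → f'.read x (φ x + v) = 0 := by
    intro v hv
    let D := VecField.const x v
    let F : ℕ → Hol n V' := fun k => (D.app hVc)^[k] f'
    let ℓ : ℂ → Cn n := fun t => φ x + t • v
    let S : Set ℂ := ℓ ⁻¹' Metric.ball (φ x) r
    have hℓ : ∀ t, HasDerivAt ℓ v t := fun t => 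
      HasDerivAt.const_add (φ x) (by simpa using (hasDerivAt_id t).smul_const v)
    have hS : IsOpen S := Metric.isOpen_ball.preimage
      (continuous_iff_continuousAt.2 fun t => (hℓ t).continuousAt)
    have hderiv : ∀ k, ∀ t ∈ S,
        HasDerivAt (fun t => (F k).read x (ℓ t)) ((F (k + 1)).read x (ℓ t)) t := by
      intro k t ht
      obtain ⟨y, hy, hyt⟩ := hpt _ ht
      have h1 : HasFDerivAt ((F k).read x) (fderiv ℂ ((F k).read x) (ℓ t)) (ℓ t) := by
        rw [← hyt]
        exact ((F k).differentiableAt_read x hy (hVc hy)).hasFDerivAt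
      have h2 : (F (k + 1)).read x (ℓ t) = fderiv ℂ ((F k).read x) (ℓ t) v := by
        rw [← hyt, Hol.read_apply x _ hy (hVc hy)]
        simp only [F, Function.iterate_succ_apply']
        exact VecField.const_app_apply x v hVc _ ⟨y, hy⟩
      rw [h2]
      exact h1.comp_hasDerivAt t (hℓ t)
    have hiter : ∀ k, ∀ t ∈ S, iteratedDeriv k (fun t => f'.read x (ℓ t)) t = (F k).read x (ℓ t) := by
      intro k
      induction k with
      | zero => intro t ht; simp [F]
      | succ k ih =>
        intro t ht
        rw [iteratedDeriv_succ]
        have : iteratedDeriv k (fun t => f'.read x (ℓ t)) =ᶠ[nhds t] fun t => (F k).read x (ℓ t) :=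
          Filter.eventually_of_mem (hS.mem_nhds ht) ih
        rw [this.deriv_eq, (hderiv k t ht).deriv]
    -- `R > 1` puts `t = 1` inside the disc of convergence, while `R ‖v‖ < r` keeps the line in the
    -- ball.
    obtain ⟨R, hR, hRr⟩ : ∃ R : ℝ, 1 < R ∧ R * ‖v‖ < r := by
      have h1 : Filter.Tendsto (fun R : ℝ => R * ‖v‖) (nhdsWithin 1 (Set.Ioi 1)) (nhds (1 * ‖v‖)) :=
        ((continuous_id.mul continuous_const).tendsto 1).mono_left nhdsWithin_le_nhds
      rw [one_mul] at h1
      obtain ⟨R, h2, h3⟩ := ((h1.eventually (gt_mem_nhds hv)).and self_mem_nhdsWithin).exists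
      exact ⟨R, h3, h2⟩
    have hsub : Metric.ball (0 : ℂ) R ⊆ S := by
      intro t ht
      rw [mem_ball_zero_iff] at ht
      simp only [S, ℓ, Set.mem_preimage, mem_ball_iff_norm, add_sub_cancel_left, norm_smul]
      exact (mul_le_mul_of_nonneg_right ht.le (norm_nonneg _)).trans_lt hRr
    have hdiff : DifferentiableOn ℂ (fun t => f'.read x (ℓ t)) (Metric.ball 0 R) := fun t ht =>
      (hderiv 0 t (hsub ht)).differentiableAt.differentiableWithinAt
    have hsum := Complex.hasSum_taylorSeries_on_ball hdiff (z := 1) (by simpa using hR)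
    have hzero : ∀ k, iteratedDeriv k (fun t => f'.read x (ℓ t)) 0 = 0 := fun k => by
      rw [hiter k 0 (hsub (by simpa using one_pos.trans hR))]
      have : ℓ 0 = φ x := by simp [ℓ]
      rw [this, Hol.read_apply x _ hx' hxc]
      exact (hf' k).iterate_app D hVc
    simp only [hzero, smul_zero] at hsum
    simpa [ℓ] using hsum.unique hasSum_zero
  let W : Opens X := ⟨V' ∩ (φ.source ∩ φ ⁻¹' Metric.ball (φ x) r), V'.isOpen.inter
    (φ.isOpen_inter_preimage Metric.isOpen_ball)⟩
  refine ⟨W, fun y hy => hy.1.1, ⟨hx', hxc, Metric.mem_ball_self hr⟩, ?_⟩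
  ext y
  have h := key (φ y - φ x) (mem_ball_iff_norm.1 y.2.2.2)
  rw [add_sub_cancel, Hol.read_apply x _ y.2.1 y.2.2.1] at h
  exact h

end HolGauge

/-! ### Coherent sheaves with a connection are locally free. -/

namespace HolGauge
variable {n : ℕ} {X : Type} [TopologicalSpace X] [ChartedSpace (Cn n) X]

lemma exists_common_nhd {ι : Type*} [Finite ι] {x : X} {V : Opens X} (hx : x ∈ V)
    (P : ι → Opens X → Prop) (hP : ∀ i, ∃ W ≤ V, x ∈ W ∧ P i W)
    (hmono : ∀ i (W W' : Opens X), W' ≤ W → P i W → P i W') :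
    ∃ W ≤ V, x ∈ W ∧ ∀ i, P i W := by
  choose W hWV hxW hPW using hP
  let W' : Opens X := ⟨V ∩ ⋂ i, (W i : Set X),
    V.isOpen.inter (isOpen_iInter_of_finite fun i => (W i).isOpen)⟩
  exact ⟨W', fun y hy => hy.1, ⟨hx, Set.mem_iInter.2 hxW⟩,
    fun i => hmono i (W i) W' (fun y hy => Set.mem_iInter.1 hy.2 i) (hPW i)⟩

lemma Hol.exists_inverse {V : Opens X} (f : Hol n V) {x : X} (hx : x ∈ V) (hf : f ⟨x, hx⟩ ≠ 0) :
    ∃ (W : Opens X) (hW : W ≤ V) (_ : x ∈ W) (g : Hol n W), g * Hol.res hW f = 1 := by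
  let W : Opens X := ⟨V ∩ {y | f.ext y ≠ 0}, by
    rw [isOpen_iff_mem_nhds]
    intro y hy
    exact Filter.inter_mem (V.isOpen.mem_nhds hy.1)
      ((f.contMDiffAt_ext hy.1).continuousAt.eventually_ne hy.2)⟩
  have hW : W ≤ V := fun y hy => hy.1
  refine ⟨W, hW, ⟨hx, by simpa [f.ext_apply hx] using hf⟩,
    Hol.ofFun W (fun y => (f.ext y)⁻¹) fun y hy => ?_, ?_⟩
  · exact (contMDiffAt_iff_contDiffAt.2 (contDiffAt_inv ℂ hy.2)).comp y (f.contMDiffAt_ext hy.1)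
  · ext y
    have h := inv_mul_cancel₀ (show f.ext y ≠ 0 from y.2.2)
    rw [f.ext_apply (hW y.2)] at h
    exact (congrArg (·⁻¹ * _) (f.ext_apply (hW y.2))).trans h

/-- The sections `e` generate `F` locally on `U`. -/
def Generates {F : PMod n X} {U : Opens X} {m : ℕ} (e : Fin m → Sec F U) : Prop :=
  ∀ (V : Opens X) (hV : V ≤ U) (t : Sec F V), ∀ y ∈ V,
    ∃ (W : Opens X) (hW : W ≤ V) (_ : y ∈ W) (f : Fin m → Hol n W),
      Sec.res hW t = ∑ a, f a • Sec.res (hW.trans hV) (e a)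

/-- Take the least number of generators over all neighbourhoods of `x`. A relation with a
coefficient that is non-zero at `x` could be solved for that generator near `x`, leaving one
generator fewer. -/
lemma exists_minimal_generators {F : PMod n X} (hF : IsFiniteType F) (x : X) :
    ∃ (U : Opens X) (_ : x ∈ U) (m : ℕ) (e : Fin m → Sec F U), Generates e ∧
      ∀ (V : Opens X) (hV : V ≤ U) (hx : x ∈ V) (f : Fin m → Hol n V),
        ∑ a, f a • Sec.res hV (e a) = 0 → ∀ a, f a ⟨x, hx⟩ = 0 := by
  classical
  have hex : ∃ (m : ℕ) (U : Opens X) (_ : x ∈ U) (e : Fin m → Sec F U), Generates e := by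
    obtain ⟨U, hx, m, e, he⟩ := hF x
    exact ⟨m, U, hx, e, he⟩
  obtain ⟨U, hxU, e, he⟩ := Nat.find_spec hex
  refine ⟨U, hxU, _, e, he, fun V hV hx f hf a => ?_⟩
  by_contra hne
  obtain ⟨m', hm'⟩ : ∃ m', Nat.find hex = m' + 1 := ⟨Nat.find hex - 1, by have := a.2; omega⟩
  have hmin := Nat.find_min hex (m := m') (by omega)
  revert e f a
  rw [hm']
  intro e he f hf a hne
  obtain ⟨W, hW, hxW, g, hg⟩ := (f a).exists_inverse hx hne
  refine hmin ⟨W, hxW, fun b => Sec.res (hW.trans hV) (e (a.succAbove b)), fun V' hV' t y hy => ?_⟩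
  obtain ⟨W', hW', hyW', c, hc⟩ := he V' ((hV'.trans hW).trans hV) t y hy
  have hWW : W' ≤ W := hW'.trans hV'
  -- Substituting `e_a = -g ∑ f_b e_b`, the sum over `b ≠ a`, into `t = ∑ c_b e_b` gives these
  -- coefficients.
  refine ⟨W', hW', hyW', fun b => c (a.succAbove b) -
    c a * Hol.res hWW g * Hol.res (hWW.trans hW) (f (a.succAbove b)), ?_⟩
  have hrel := congrArg (Sec.res (hWW.trans hW)) hf
  simp only [Sec.res_sum, Sec.res_smul, Sec.res_res, map_zero] at hrel
  rw [Fin.sum_univ_succAbove _ a] at hrel hc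
  have hg' : Hol.res hWW g * Hol.res (hWW.trans hW) (f a) = 1 := by
    have := congrArg (Hol.res hWW) hg
    rwa [map_mul, map_one, Hol.res_res] at this
  have hrel' := congrArg (fun s => (c a * Hol.res hWW g) • s) hrel
  simp only [smul_add, smul_zero, smul_smul, mul_assoc, hg', mul_one, Finset.smul_sum] at hrel'
  rw [hc, eq_neg_of_add_eq_zero_left hrel']
  simp only [Sec.res_res, sub_smul, Finset.sum_sub_distrib, mul_assoc]
  abel

variable {F : OMod n X}

/-- The coefficients of relations between minimal generators vanish to infinite order, because
a connection turns the derivatives of a relation into a relation. -/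
lemma vanishesToOrder_of_relation (c : HolConnection F) {x : X} {U : Opens X} {m : ℕ}
    {e : Fin m → Sec F.val U} (he : Generates e)
    (hmin : ∀ (V : Opens X) (hV : V ≤ U) (hx : x ∈ V) (f : Fin m → Hol n V),
        ∑ a, f a • Sec.res hV (e a) = 0 → ∀ a, f a ⟨x, hx⟩ = 0) (k : ℕ) :
    ∀ (V : Opens X) (hV : V ≤ U) (hx : x ∈ V) (f : Fin m → Hol n V),
        ∑ a, f a • Sec.res hV (e a) = 0 → ∀ a, VanishesToOrder x k V hx (f a) := by
  induction k with
  | zero => exact hmin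
  | succ k ih =>
    intro V hV hx f hf a
    refine ⟨hmin V hV hx f hf a, fun W hW hxW D => ?_⟩
    have hWU := hW.trans hV
    -- The coefficients `Γ` of `∇_D e_a` in terms of the generators, on one neighbourhood for all
    -- `a`. They need not be unique.
    obtain ⟨W', hW', hxW', hΓ⟩ := exists_common_nhd hxW
      (fun a W' => ∃ (hW' : W' ≤ W) (Γ : Fin m → Hol n W'),
        Sec.res hW' (c.cov D (Sec.res hWU (e a))) =
          ∑ b, Γ b • Sec.res (hW'.trans hWU) (e b))
      (fun a => by
        obtain ⟨W', hW', hxW', Γ, hΓ⟩ := he W hWU (c.cov D (Sec.res hWU (e a))) x hxW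
        exact ⟨W', hW', hxW', hW', Γ, hΓ⟩)
      (fun a W₁ W₂ h ⟨hW₁, Γ, hΓ⟩ => ⟨h.trans hW₁, fun b => Hol.res h (Γ b), by
        have := congrArg (Sec.res h) hΓ
        simpa only [Sec.res_sum, Sec.res_smul, Sec.res_res] using this⟩)
    choose _ Γ hΓ using hΓ
    have hW'V := hW'.trans hW
    have hrel := congrArg (fun s => Sec.res hW' (c.cov D (Sec.res hW s))) hf
    simp only [Sec.res_sum, Sec.res_smul, Sec.res_res, map_zero, c.cov_zero, c.cov_sum,
      c.cov_leibniz, map_add, hΓ, Hol.res_res, Finset.sum_add_distrib, Finset.smul_sum,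
      smul_smul] at hrel
    rw [Finset.sum_comm, ← Finset.sum_add_distrib] at hrel
    -- The derivative of the relation, regrouped by generators. By induction its coefficients and
    -- the `f a` vanish to order `k`, hence so do the derivatives `D f_b`.
    have hrel' : ∑ b, (∑ a, Hol.res hW'V (f a) * Γ a b + Hol.res hW' (D.app le_rfl
        (Hol.res hW (f b)))) • Sec.res (hW'V.trans hV) (e b) = 0 := by
      simpa only [add_smul, Finset.sum_smul] using hrel
    have h1 := ih W' (hW'V.trans hV) hxW' _ hrel' a
    have h2 : VanishesToOrder x k W' hxW' (∑ b, Hol.res hW'V (f b) * Γ b a) :=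
      VanishesToOrder.sum _ fun b _ => by
        rw [mul_comm]
        exact ((ih V hV hx f hf b).res hW'V hxW').mul_left _
    refine VanishesToOrder.of_res hW' hxW' ?_
    simpa using h1.add h2.neg

variable [IsManifold 𝓘(ℂ, Cn n) ω X]

/-- A coherent sheaf with a holomorphic connection is locally free. -/
theorem locallyFreeAt_of_connection (hF : IsCoherent F.val) (c : HolConnection F) (x : X) :
    LocallyFreeAt F.val x := by
  obtain ⟨U, hxU, m, e, he, hmin⟩ := exists_minimal_generators hF.1 x
  obtain ⟨V, hV, hxV, k, ρ, hρ, hgen⟩ := hF.2 U m e x hxU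
  -- Each coefficient of each generating relation vanishes near `x`. There are finitely many of
  -- them, so one neighbourhood serves for all.
  obtain ⟨V', hV', hxV', hzero⟩ := exists_common_nhd hxV
    (fun (p : Fin k × Fin m) W => ∃ hW : W ≤ V, Hol.res hW (ρ p.1 p.2) = 0)
    (fun p => by
      obtain ⟨W, hW, hxW, h⟩ := eventually_zero_of_vanishesToOrder hxV (ρ p.1 p.2) fun k =>
        vanishesToOrder_of_relation c he hmin k V hV hxV (ρ p.1) (hρ p.1) p.2
      exact ⟨W, hW, hxW, hW, h⟩)
    (fun p W₁ W₂ h ⟨hW₁, h0⟩ => ⟨h.trans hW₁, by rw [← Hol.res_res hW₁ h, h0, map_zero]⟩)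
  have hV'U := hV'.trans hV
  have huniq : ∀ (W : Opens X) (hW : W ≤ V') (f : Fin m → Hol n W),
      ∑ a, f a • Sec.res (hW.trans hV'U) (e a) = 0 → ∀ a, f a = 0 := by
    intro W hW f hf a
    ext y
    obtain ⟨W', hW', hy, d, hd⟩ := hgen W (hW.trans hV') f hf y y.2
    have hz : ∀ b, Hol.res ((hW'.trans hW).trans hV') (ρ b a) = 0 := fun b => by
      obtain ⟨h, h0⟩ := hzero (b, a)
      rw [← Hol.res_res h (hW'.trans hW), h0, map_zero]
    have := hd a
    simp only [hz, mul_zero, Finset.sum_const_zero] at this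
    exact congrArg (fun g : Hol n W' => g ⟨y, hy⟩) this
  refine ⟨V', hxV', m, fun a => Sec.res hV'U (e a), fun W hW t => ?_⟩
  simp only [Sec.res_res]
  have hWU := hW.trans hV'U
  choose N hN hyN f hf using he W hWU t
  -- Generation is only local. As the generators are now independent, the local coefficients agree
  -- on overlaps and glue over `W`.
  have hagree : ∀ y (hy : y ∈ W) z (hz : z ∈ W) w (hwy : w ∈ N y hy) (hwz : w ∈ N z hz) (a : Fin m),
      f y hy a ⟨w, hwy⟩ = f z hz a ⟨w, hwz⟩ := by
    intro y hy z hz w hwy hwz a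
    have h1 := congrArg (Sec.res (inf_le_left : N y hy ⊓ N z hz ≤ N y hy)) (hf y hy)
    have h2 := congrArg (Sec.res (inf_le_right : N y hy ⊓ N z hz ≤ N z hz)) (hf z hz)
    simp only [Sec.res_res, Sec.res_sum, Sec.res_smul] at h1 h2
    have h3 := huniq (N y hy ⊓ N z hz) (inf_le_left.trans ((hN y hy).trans hW))
      (fun a => Hol.res inf_le_left (f y hy a) - Hol.res inf_le_right (f z hz a)) (by
        simp only [sub_smul, Finset.sum_sub_distrib]
        rw [← h1, ← h2, sub_self]) a
    exact sub_eq_zero.1 (congrArg (fun g : Hol n (N y hy ⊓ N z hz) => g ⟨w, hwy, hwz⟩) h3)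
  classical
  let F' : Fin m → X → ℂ := fun a y => if hy : y ∈ W then (f y hy a).ext y else 0
  have hF' : ∀ a y (hy : y ∈ W) w, w ∈ N y hy → F' a w = (f y hy a).ext w := by
    intro a y hy w hw
    have hwW := hN y hy hw
    simp only [F', dif_pos hwW]
    rw [Hol.ext_apply _ (hyN w hwW), Hol.ext_apply _ hw]
    exact hagree _ _ _ _ _ _ _ _
  let g : Fin m → Hol n W := fun a => Hol.ofFun W (F' a) fun y hy =>
    ((f y hy a).contMDiffAt_ext (hyN y hy)).congr_of_eventuallyEq
      (Filter.eventually_of_mem ((N y hy).isOpen.mem_nhds (hyN y hy)) (hF' a y hy))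
  have hg : t = ∑ a, g a • Sec.res hWU (e a) := by
    refine Sec.eq_of_locally_eq F (fun y : W => N y y.2) (fun y => hN y y.2) (fun y hy =>
      Opens.mem_iSup.2 ⟨⟨y, hy⟩, hyN y hy⟩) _ _ fun y => ?_
    rw [hf y y.2, Sec.res_sum]
    refine Finset.sum_congr rfl fun a _ => ?_
    rw [Sec.res_smul, Sec.res_res]
    congr 1
    ext w
    exact ((Hol.ext_apply _ w.2).symm.trans (hF' a y y.2 w w.2).symm)
  refine ⟨g, hg, fun g' hg' => funext fun a => ?_⟩
  have h := huniq W hW (fun a => g' a - g a) (by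
    simp only [sub_smul, Finset.sum_sub_distrib]
    rw [← hg', ← hg, sub_self]) a
  exact sub_eq_zero.1 h

end HolGauge

namespace HolGauge
variable {n : ℕ} {X : Type} [TopologicalSpace X] [ChartedSpace (Cn n) X]

/-! ### Real derivatives in charts -/

/-- Holomorphic transition maps are smooth over `ℝ`. -/
lemma isManifold_real [IsManifold 𝓘(ℂ, Cn n) ω X] : IsManifold 𝓘(ℝ, Cn n) ∞ X := by
  refine isManifold_of_contDiffOn _ _ _ fun e e' he he' => ?_
  have h := contDiffGroupoid_le (I := 𝓘(ℂ, Cn n)) (m := ∞) (n := ω) le_top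
    ((contDiffGroupoid ω 𝓘(ℂ, Cn n)).compatible he he')
  exact ContDiffOn.restrict_scalars ℝ (mem_groupoid_of_pregroupoid.1 h).1

lemma realDeriv_eq_fderiv {φ : X → ℂ} {x : X}
    (hφ : MDifferentiableAt 𝓘(ℝ, Cn n) 𝓘(ℝ, ℂ) φ x) (ξ : Cn n) :
    realDeriv φ x ξ =
      fderiv ℝ (fun z => φ ((chartAt (Cn n) x).symm z)) (chartAt (Cn n) x x) ξ := by
  rw [realDeriv, hφ.mfderiv]
  simp only [writtenInExtChartAt, mfld_simps, fderivWithin_univ]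
  rfl

lemma realDeriv_add {φ ψ : X → ℂ} {x : X}
    (hφ : MDifferentiableAt 𝓘(ℝ, Cn n) 𝓘(ℝ, ℂ) φ x)
    (hψ : MDifferentiableAt 𝓘(ℝ, Cn n) 𝓘(ℝ, ℂ) ψ x) (ξ : Cn n) :
    realDeriv (fun y => φ y + ψ y) x ξ = realDeriv φ x ξ + realDeriv ψ x ξ := by
  have h := (hφ.hasMFDerivAt.add hψ.hasMFDerivAt).mfderiv
  exact congrArg (fun L : Cn n →L[ℝ] ℂ => L ξ) h

lemma realDeriv_mul {φ ψ : X → ℂ} {x : X}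
    (hφ : MDifferentiableAt 𝓘(ℝ, Cn n) 𝓘(ℝ, ℂ) φ x)
    (hψ : MDifferentiableAt 𝓘(ℝ, Cn n) 𝓘(ℝ, ℂ) ψ x) (ξ : Cn n) :
    realDeriv (fun y => φ y * ψ y) x ξ = φ x * realDeriv ψ x ξ + ψ x * realDeriv φ x ξ := by
  have h := (hφ.hasMFDerivAt.mul hψ.hasMFDerivAt).mfderiv
  exact congrArg (fun L : Cn n →L[ℝ] ℂ => L ξ) h

lemma realDeriv_congr {φ ψ : X → ℂ} {x : X} (h : φ =ᶠ[nhds x] ψ) (ξ : Cn n) :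
    realDeriv φ x ξ = realDeriv ψ x ξ := by
  have h := h.mfderiv_eq (I := 𝓘(ℝ, Cn n)) (I' := 𝓘(ℝ, ℂ))
  exact congrArg (fun L : Cn n →L[ℝ] ℂ => L ξ) h

section
variable [IsManifold 𝓘(ℂ, Cn n) ω X] (c : X)

lemma contMDiffAt_real_chart {x : X} (hc : x ∈ chartDomain n c) :
    ContMDiffAt 𝓘(ℝ, Cn n) 𝓘(ℝ, Cn n) ∞ (chartAt (Cn n) c) x :=
  have := isManifold_real (n := n) (X := X)
  contMDiffOn_chart.contMDiffAt ((chartAt (Cn n) c).open_source.mem_nhds hc)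

lemma contDiffAt_real_read {φ : X → ℂ} {x : X} (hc : x ∈ chartDomain n c)
    (hφ : ContMDiffAt 𝓘(ℝ, Cn n) 𝓘(ℝ, ℂ) ∞ φ x) :
    ContDiffAt ℝ ∞ (fun z => φ ((chartAt (Cn n) c).symm z)) (chartAt (Cn n) c x) := by
  have := isManifold_real (n := n) (X := X)
  have h1 : ContMDiffAt 𝓘(ℝ, Cn n) 𝓘(ℝ, Cn n) ∞ (chartAt (Cn n) c).symm (chartAt (Cn n) c x) :=
    contMDiffOn_chart_symm.contMDiffAt
      ((chartAt (Cn n) c).open_target.mem_nhds ((chartAt (Cn n) c).map_source hc))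
  rw [← (chartAt (Cn n) c).left_inv hc] at hφ
  exact contMDiffAt_iff_contDiffAt.1 (hφ.comp _ h1)

lemma contMDiffAt_of_read {φ : X → ℂ} {x : X} (hc : x ∈ chartDomain n c)
    (hφ : ContDiffAt ℝ ∞ (fun z => φ ((chartAt (Cn n) c).symm z)) (chartAt (Cn n) c x)) :
    ContMDiffAt 𝓘(ℝ, Cn n) 𝓘(ℝ, ℂ) ∞ φ x := by
  refine ((contMDiffAt_iff_contDiffAt.2 hφ).comp x
    (contMDiffAt_real_chart c hc)).congr_of_eventuallyEq ?_
  filter_upwards [(chartAt (Cn n) c).open_source.mem_nhds hc] with y hy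
  simp [(chartAt (Cn n) c).left_inv hy]

lemma Hol.contMDiffAt_real_ext {V : Opens X} (f : Hol n V) {x : X} (hx : x ∈ V) :
    ContMDiffAt 𝓘(ℝ, Cn n) 𝓘(ℝ, ℂ) ∞ f.ext x :=
  contMDiffAt_of_read x (mem_chart_source _ x)
    ((f.contDiffAt_read x hx (mem_chart_source _ x)).restrict_scalars ℝ)

/-- The real derivative in the preferred chart at `c`. -/
lemma realDeriv_eq_fderiv_read {φ : X → ℂ} {x : X} (hc : x ∈ chartDomain n c)
    (hφ : ContMDiffAt 𝓘(ℝ, Cn n) 𝓘(ℝ, ℂ) ∞ φ x) (ξ : Cn n) :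
    realDeriv φ x ξ = fderiv ℝ (fun z => φ ((chartAt (Cn n) c).symm z)) (chartAt (Cn n) c x)
      (mfderiv 𝓘(ℝ, Cn n) 𝓘(ℝ, Cn n) (chartAt (Cn n) c) x (ξ : TangentSpace 𝓘(ℝ, Cn n) x)) := by
  have h1 := ((contDiffAt_real_read c hc hφ).differentiableAt (by simp)).hasFDerivAt.hasMFDerivAt
  have h2 := ((contMDiffAt_real_chart c hc).mdifferentiableAt (by simp)).hasMFDerivAt
  have h3 := (h1.comp x h2).mfderiv
  rw [realDeriv_congr (ψ := (fun z => φ ((chartAt (Cn n) c).symm z)) ∘ chartAt (Cn n) c), realDeriv,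
    h3]
  · rfl
  · filter_upwards [(chartAt (Cn n) c).open_source.mem_nhds hc] with y hy
    simp [(chartAt (Cn n) c).left_inv hy]

/-- The components of a vector field in the preferred chart at `c`. -/
def VecField.coord {U : Opens X} (D : VecField n U) (c : X) (j : Fin n) : Hol n (U ⊓ chartDomain n c) :=
  D.app inf_le_left (Hol.res inf_le_right (coordinate c j))

/-- A vector field in the preferred chart at `c`. -/
def VecField.read {U : Opens X} (D : VecField n U) (c : X) (z : Cn n) : Cn n :=
  WithLp.toLp 2 fun j => (D.coord c j).read c z

lemma VecField.contDiffAt_read {U : Opens X} (D : VecField n U) {x : X} (hx : x ∈ U)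
    (hc : x ∈ chartDomain n c) : ContDiffAt ℝ ∞ (D.read c) (chartAt (Cn n) c x) := by
  rw [contDiffAt_piLp]
  exact fun j => ((D.coord c j).contDiffAt_read c ⟨hx, hc⟩ hc).restrict_scalars ℝ

lemma VecField.value_res {U V : Opens X} (h : V ≤ U) (D : VecField n U) {x : X} (hx : x ∈ V) :
    (VecField.res h D).value x hx = D.value x (h hx) := by
  ext j
  exact congrArg (fun f : Hol n (V ⊓ chartDomain n x) => f ⟨x, hx, mem_chart_source _ x⟩)
    (D.app_res (inf_le_left : U ⊓ chartDomain n x ≤ U) (inf_le_inf_right _ h)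
      (Hol.res inf_le_right (coordinate x j)))

end

/-- The commutator of two vector fields, applied to a function. -/
lemma fderiv_fderiv_sub_comm {E : Type*} [NormedAddCommGroup E] [NormedSpace ℝ E] {Φ : E → ℂ}
    {d e : E → E} {p : E} (hΦ : ContDiffAt ℝ ∞ Φ p) (hd : DifferentiableAt ℝ d p)
    (he : DifferentiableAt ℝ e p) :
    fderiv ℝ (fun z => fderiv ℝ Φ z (e z)) p (d p) - fderiv ℝ (fun z => fderiv ℝ Φ z (d z)) p (e p) =
      fderiv ℝ Φ p (fderiv ℝ e p (d p) - fderiv ℝ d p (e p)) := by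
  have h1 : DifferentiableAt ℝ (fderiv ℝ Φ) p :=
    (hΦ.fderiv_right (m := ∞) le_rfl).differentiableAt (by simp)
  -- Symmetry of the second derivative cancels the second-order terms and leaves the bracket of `d`
  -- and `e`.
  have hsymm : IsSymmSndFDerivAt ℝ Φ p := hΦ.isSymmSndFDerivAt (by
    simp only [minSmoothness_of_isRCLikeNormedField]; exact ENat.LEInfty.out)
  have h2 := hsymm (d p) (e p)
  rw [(h1.hasFDerivAt.clm_apply he.hasFDerivAt).fderiv,
    (h1.hasFDerivAt.clm_apply hd.hasFDerivAt).fderiv]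
  simp only [add_apply, ContinuousLinearMap.comp_apply,
    ContinuousLinearMap.flip_apply, h2, map_sub]
  ring

/-! ### Flatness of metric connections -/
lemma IsHermitianMetric.contMDiffAt_pairing {F : OMod n X} {h : Pairing F.val}
    (H : IsHermitianMetric h) (hF : singularSet F.val = ∅) {U : Opens X} {x : X}
    (s t : Sec F.val U) (hx : x ∈ U) : ContMDiffAt 𝓘(ℝ, Cn n) 𝓘(ℝ, ℂ) ∞ (h U s t) x := by
  have := H.smooth U s t
  rw [hF, Set.sdiff_empty] at this
  exact this.contMDiffAt (U.isOpen.mem_nhds hx)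

namespace HolConnection.MetricCompatible
variable [IsManifold 𝓘(ℂ, Cn n) ω X] {F : OMod n X} {c : HolConnection F} {h : Pairing F.val}
  (hc : c.MetricCompatible h) (H : IsHermitianMetric h) (hF : singularSet F.val = ∅)
  {U : Opens X} {x : X}

include hc hF in
lemma realDeriv_pairing (D : VecField n U) (s t : Sec F.val U) (hx : x ∈ U) :
    realDeriv (h U s t) x (D.value x hx) = h U (c.cov D s) t x + h U s (c.cov D t) x :=
  hc U D s t x hx (by simp [hF])

include hc H hF

/-- The real derivative of a holomorphic function along the value of a vector field is the
derivation applied to the function, at points where the fibre is not zero. -/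
lemma realDeriv_ext (D : VecField n U) (f : Hol n U) (hx : x ∈ U) {s : Sec F.val U}
    (hs : h U s s x ≠ 0) : realDeriv f.ext x (D.value x hx) = D.app le_rfl f ⟨x, hx⟩ := by
  -- Differentiate `⟨f s, s⟩ = f ⟨s, s⟩` in two ways: by the product rule for functions, and by
  -- metric compatibility with the Leibniz rule for `∇`. What remains is `⟨s, s⟩ ξ(f) = ⟨s, s⟩
  -- D(f)`. The metric thus links the abstract derivation `D` to the tangent vector `ξ`.
  have hP := (H.contMDiffAt_pairing hF s s hx).mdifferentiableAt (by simp)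
  have h1 := realDeriv_mul ((f.contMDiffAt_real_ext hx).mdifferentiableAt (by simp)) hP
    (D.value x hx)
  have h2 : h U (f • s) s =ᶠ[nhds x] fun y => f.ext y * h U s s y := by
    filter_upwards [U.isOpen.mem_nhds hx] with y hy
    rw [H.smul_left U f s s y hy, f.ext_apply hy]
  rw [← realDeriv_congr h2, hc.realDeriv_pairing hF, hc.realDeriv_pairing hF, c.cov_leibniz,
    H.add_left U _ _ _ x hx, H.smul_left U _ _ _ x hx, H.smul_left U _ _ _ x hx,
    H.smul_left U _ _ _ x hx, f.ext_apply hx] at h1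
  refine mul_right_cancel₀ hs ?_
  linear_combination -h1

/-- The coordinates of `D.value x` refer to the preferred chart at `x`, which varies with `x`.
Second derivatives need one fixed chart at `p`; `realDeriv_ext`, applied to its coordinate
functions, gives the transition. -/
lemma mfderiv_chart (D : VecField n U) (hx : x ∈ U) {s : Sec F.val U} (hs : h U s s x ≠ 0)
    (p : X) (hp : x ∈ chartDomain n p) :
    mfderiv 𝓘(ℝ, Cn n) 𝓘(ℝ, Cn n) (chartAt (Cn n) p) x
      (D.value x hx : TangentSpace 𝓘(ℝ, Cn n) x) = D.read p (chartAt (Cn n) p x) := by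
  let V := U ⊓ chartDomain n p
  have hs' : h V (Sec.res inf_le_left s) (Sec.res inf_le_left s) x ≠ 0 := by
    rwa [H.res U V inf_le_left s s x ⟨hx, hp⟩]
  refine PiLp.ext fun j => ?_
  have h1 := hc.realDeriv_ext H hF (VecField.res inf_le_left D) (Hol.res inf_le_right (coordinate p j))
    (show x ∈ V from ⟨hx, hp⟩) hs'
  have h2 : (D.coord p j).read p (chartAt (Cn n) p x) = D.coord p j ⟨x, hx, hp⟩ :=
    Hol.read_apply (V := V) p (D.coord p j) ⟨hx, hp⟩ hp
  refine Eq.trans ?_ (h1.trans h2.symm)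
  have h3 := ((contMDiffAt_real_chart p hp).mdifferentiableAt (by simp)).hasMFDerivAt
  have h4 := ((EuclideanSpace.proj j : Cn n →L[ℂ] ℂ).restrictScalars ℝ).hasFDerivAt.hasMFDerivAt
    (x := chartAt (Cn n) p x)
  have h5 := (h4.comp x h3).mfderiv
  rw [realDeriv_congr (ψ := (EuclideanSpace.proj j : Cn n →L[ℂ] ℂ).restrictScalars ℝ ∘ chartAt (Cn n) p),
    realDeriv, h5, VecField.value_res]
  · rfl
  · filter_upwards [V.isOpen.mem_nhds ⟨hx, hp⟩] with y hy
    rw [Hol.ext_apply _ hy]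
    rfl

/-- The derivative of a smooth function along a vector field in the chart at `p`. -/
lemma realDeriv_read (D : VecField n U) (hx : x ∈ U) {s : Sec F.val U} (hs : h U s s x ≠ 0)
    (p : X) (hp : x ∈ chartDomain n p) {φ : X → ℂ} (hφ : ContMDiffAt 𝓘(ℝ, Cn n) 𝓘(ℝ, ℂ) ∞ φ x) :
    realDeriv φ x (D.value x hx) = fderiv ℝ (fun z => φ ((chartAt (Cn n) p).symm z))
      (chartAt (Cn n) p x) (D.read p (chartAt (Cn n) p x)) := by
  rw [realDeriv_eq_fderiv_read p hp hφ, hc.mfderiv_chart H hF D hx hs p hp]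

/-- Metric compatibility used twice. The formula for the first derivative must hold on a
neighbourhood before it is differentiated; `⟨s₀, s₀⟩ ≠ 0` is an open condition, so it does. -/
lemma fderiv_fderiv_pairing (D E : VecField n U) (s t : Sec F.val U) (hx : x ∈ U)
    {s₀ : Sec F.val U} (hs : h U s₀ s₀ x ≠ 0) :
    fderiv ℝ (fun z => fderiv ℝ (fun z => h U s t ((chartAt (Cn n) x).symm z)) z (E.read x z))
        (chartAt (Cn n) x x) (D.read x (chartAt (Cn n) x x)) =
      h U (c.cov D (c.cov E s)) t x + h U (c.cov E s) (c.cov D t) x +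
        (h U (c.cov D s) (c.cov E t) x + h U s (c.cov D (c.cov E t)) x) := by
  have hxc : x ∈ chartDomain n x := mem_chart_source _ x
  have hS := fun (s t : Sec F.val U) y hy => H.contMDiffAt_pairing (x := y) hF s t hy
  have hev : ∀ᶠ y in nhds x, y ∈ U ∧ y ∈ chartDomain n x ∧ h U s₀ s₀ y ≠ 0 :=
    (U.isOpen.eventually_mem hx).and
      (((chartDomain n x).isOpen.eventually_mem hxc).and
        ((hS s₀ s₀ x hx).continuousAt.eventually_ne hs))
  have heq : (fun z => fderiv ℝ (fun z => h U s t ((chartAt (Cn n) x).symm z)) z (E.read x z))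
      =ᶠ[nhds (chartAt (Cn n) x x)] fun z =>
        (fun y => h U (c.cov E s) t y + h U s (c.cov E t) y) ((chartAt (Cn n) x).symm z) := by
    filter_upwards [Hol.eventually_nhds_chart x hxc hev,
      (chartAt (Cn n) x).open_target.mem_nhds ((chartAt (Cn n) x).map_source hxc)] with z hz hz'
    obtain ⟨hzU, hzc, hz0⟩ := hz
    have h1 := hc.realDeriv_read H hF E hzU hz0 x hzc (hS s t _ hzU)
    rw [(chartAt (Cn n) x).right_inv hz'] at h1
    rw [← h1, hc.realDeriv_pairing hF]
  rw [heq.fderiv_eq, ← hc.realDeriv_read H hF D hx hs x hxc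
      (φ := fun y => h U (c.cov E s) t y + h U s (c.cov E t) y) ((hS _ _ x hx).add (hS _ _ x hx)),
    realDeriv_add ((hS _ _ x hx).mdifferentiableAt (by simp))
      ((hS _ _ x hx).mdifferentiableAt (by simp)),
    hc.realDeriv_pairing hF, hc.realDeriv_pairing hF]

/-- Differentiating the components of `E` along the real vector of `D` is applying the derivation
`D` to them, as they are holomorphic. So the real and the holomorphic brackets agree. -/
lemma bracket_value (D E : VecField n U) (hx : x ∈ U) {s : Sec F.val U} (hs : h U s s x ≠ 0) :
    fderiv ℝ (E.read x) (chartAt (Cn n) x x) (D.read x (chartAt (Cn n) x x)) -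
      fderiv ℝ (D.read x) (chartAt (Cn n) x x) (E.read x (chartAt (Cn n) x x)) =
        (VecField.bracket D E).value x hx := by
  have hxc : x ∈ chartDomain n x := mem_chart_source _ x
  have key : ∀ (D E : VecField n U) (j : Fin n),
      fderiv ℝ (E.read x) (chartAt (Cn n) x x) (D.read x (chartAt (Cn n) x x)) j =
        D.app inf_le_left (E.coord x j) ⟨x, hx, hxc⟩ := by
    intro D E j
    have hs' : h (U ⊓ chartDomain n x) (Sec.res inf_le_left s) (Sec.res inf_le_left s) x ≠ 0 := by
      rwa [H.res U _ inf_le_left s s x ⟨hx, hxc⟩]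
    have h1 := hc.realDeriv_ext H hF (VecField.res inf_le_left D) (E.coord x j) ⟨hx, hxc⟩ hs'
    refine Eq.trans ?_ h1
    have h2 : (VecField.res (inf_le_left : U ⊓ chartDomain n x ≤ U) D).value x ⟨hx, hxc⟩ =
      D.value x hx := VecField.value_res _ D _
    rw [h2, hc.realDeriv_read H hF D hx hs x hxc ((E.coord x j).contMDiffAt_real_ext ⟨hx, hxc⟩)]
    have h3 := ((E.contDiffAt_read x hx hxc).differentiableAt (by simp)).hasFDerivAt
    have h4 := ((EuclideanSpace.proj j : Cn n →L[ℂ] ℂ).restrictScalars ℝ).hasFDerivAt.comp _ h3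
    exact (congrArg (fun L : Cn n →L[ℝ] ℂ => L (D.read x (chartAt (Cn n) x x))) h4.fderiv).symm
  refine PiLp.ext fun j => ?_
  rw [PiLp.sub_apply, key, key]
  rfl

/-- The curvature is skew-Hermitian: in the commutator of the second derivatives of `⟨s, t⟩` the
mixed terms `⟨∇_D s, ∇_E t⟩` and `⟨∇_E s, ∇_D t⟩` cancel. -/
lemma pairing_curvature_add (D E : VecField n U) (s t : Sec F.val U) (hx : x ∈ U)
    {s₀ : Sec F.val U} (hs : h U s₀ s₀ x ≠ 0) :
    h U (c.curvature D E s) t x + h U s (c.curvature D E t) x = 0 := by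
  have hxc : x ∈ chartDomain n x := mem_chart_source _ x
  have hst := H.contMDiffAt_pairing hF s t hx
  have h1 := fderiv_fderiv_sub_comm (contDiffAt_real_read x hxc hst)
    ((D.contDiffAt_read x hx hxc).differentiableAt (by simp))
    ((E.contDiffAt_read x hx hxc).differentiableAt (by simp))
  rw [hc.fderiv_fderiv_pairing H hF D E s t hx hs, hc.fderiv_fderiv_pairing H hF E D s t hx hs,
    hc.bracket_value H hF D E hx hs, ← realDeriv_eq_fderiv (hst.mdifferentiableAt (by simp)),
    hc.realDeriv_pairing hF] at h1
  simp only [curvature, H.sub_left hx, H.sub_right hx]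
  linear_combination h1

/-- A holomorphic connection that is compatible with a metric has no curvature: the curvature is
skew-Hermitian and complex linear in the first vector field. -/
lemma curvature_eq_zero_at (D E : VecField n U) (s t : Sec F.val U) (hx : x ∈ U)
    {s₀ : Sec F.val U} (hs : h U s₀ s₀ x ≠ 0) : h U (c.curvature D E s) t x = 0 := by
  have h1 := hc.pairing_curvature_add H hF D E s t hx hs
  have h2 := hc.pairing_curvature_add H hF ((constHol U Complex.I : Hol n U) • D) E s t hx hs
  rw [c.curvature_const_smul_left, c.curvature_const_smul_left, H.smul_left U _ _ _ x hx,
    H.smul_right hx] at h2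
  have h3 : (constHol U Complex.I : Hol n U) ⟨x, hx⟩ = Complex.I := rfl
  rw [h3, Complex.conj_I] at h2
  -- With `a = ⟨K s, t⟩` and `b = ⟨s, K t⟩`, the field `D` gives `a + b = 0` and `iD` gives `i a - i
  -- b = 0`, since the second slot is conjugate linear.
  have h4 : 2 * Complex.I * h U (c.curvature D E s) t x = 0 := by
    linear_combination h2 + Complex.I * h1
  simpa using h4

/-- If `K s` were non-zero in the fibre, it could itself serve as the section `s₀` of non-zero
length, and pairing it with itself would give zero. -/
lemma vanishesAt_curvature (D E : VecField n U) (s : Sec F.val U) (hx : x ∈ U) :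
    VanishesAt (c.curvature D E s) x := by
  rw [← H.definite U _ x hx]
  by_contra hne
  exact hne (hc.curvature_eq_zero_at H hF D E s _ hx hne)

end HolConnection.MetricCompatible

/-- The evaluation of holomorphic functions at a point. -/
def Hol.eval {V : Opens X} (y : V) : Hol n V →+* ℂ :=
  (Pi.evalRingHom _ y).comp ContMDiffMap.coeFnRingHom

/-- In a local frame the coefficients are unique. Expanding `s = ∑ g_i t_i` with `g_i(y) = 0` in the
frame shows that they vanish at every point `y`, hence as functions. -/
lemma eq_zero_of_vanishesAt {F : OMod n X} (hF : singularSet F.val = ∅) {U : Opens X}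
    (s : Sec F.val U) (hs : ∀ x ∈ U, VanishesAt s x) : s = 0 := by
  have hloc : ∀ x : X, LocallyFreeAt F.val x := fun x => by
    by_contra hx
    exact (hF.subset hx : x ∈ (∅ : Set X))
  choose N hxN r e he using hloc
  refine Sec.eq_of_locally_eq F (fun x : U => U ⊓ N x) (fun x => inf_le_left) (fun x hx =>
    Opens.mem_iSup.2 ⟨⟨x, hx⟩, hx, hxN x⟩) _ _ fun x => ?_
  obtain ⟨f, hf, -⟩ := he x (U ⊓ N x) inf_le_right (Sec.res inf_le_left s)
  have hf0 : ∀ a, f a = 0 := by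
    intro a
    ext y
    obtain ⟨V, hV, hyV, m, g, t, hg, ht⟩ := hs y y.2.1
    let W := V ⊓ (U ⊓ N x)
    have hW : W ≤ N x := inf_le_right.trans inf_le_right
    choose b hb _ using fun i => he x W hW (Sec.res inf_le_left (t i))
    have h1 := congrArg (Sec.res (inf_le_right : W ≤ U ⊓ N x)) hf
    have h2 := congrArg (Sec.res (inf_le_left : W ≤ V)) ht
    simp only [Sec.res_sum, Sec.res_smul, Sec.res_res, hb] at h1 h2
    have h3 : Sec.res (inf_le_left.trans hV) s =
        ∑ a, (∑ i, Hol.res inf_le_left (g i) * b i a) • Sec.res hW (e x a) := by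
      rw [h2]
      simp only [Finset.smul_sum, Finset.sum_smul, mul_smul]
      exact Finset.sum_comm
    have h4 := congrFun ((he x W hW _).unique h1 h3) a
    have h5 := congrArg (fun k : Hol n W => k ⟨y, hyV, y.2⟩) h4
    refine h5.trans ?_
    change Hol.eval (n := n) (⟨y, hyV, y.2⟩ : W) _ = 0
    rw [map_sum]
    refine Finset.sum_eq_zero fun i _ => ?_
    rw [map_mul]
    exact mul_eq_zero_of_left (hg i) _
  rw [hf]
  simp [hf0]

variable [IsManifold 𝓘(ℂ, Cn n) ω X]

/-- A metric connection on a locally free sheaf is flat. -/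
theorem HolConnection.MetricCompatible.curvature_eq_zero {F : OMod n X} {c : HolConnection F}
    {h : Pairing F.val} (hc : c.MetricCompatible h) (H : IsHermitianMetric h)
    (hF : singularSet F.val = ∅) {U : Opens X} (D E : VecField n U) (s : Sec F.val U) :
    c.curvature D E s = 0 :=
  eq_zero_of_vanishesAt hF _ fun _ hx => hc.vanishesAt_curvature H hF D E s hx

end HolGauge

namespace HolGauge
variable {n : ℕ} {X : Type} [TopologicalSpace X] [ChartedSpace (Cn n) X]

/-! ### Epimorphisms are locally surjective -/
section image
variable {F G : OMod n X} (φ : F ⟶ G)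

/-- The sections of `G` that are locally in the image of `φ`. -/
def imageSec (U : Opens X) : Submodule (Hol n U) (Sec G.val U) where
  carrier := {s | ∀ x ∈ U, ∃ (V : Opens X) (hV : V ≤ U) (_ : x ∈ V) (t : Sec F.val V),
    Sec.map φ.val V t = Sec.res hV s}
  zero_mem' := fun x hx => ⟨U, le_rfl, hx, 0, by rw [map_zero, map_zero]⟩
  add_mem' := by
    intro s s' hs hs' x hx
    obtain ⟨V, hV, hxV, t, ht⟩ := hs x hx
    obtain ⟨V', hV', hxV', t', ht'⟩ := hs' x hx
    refine ⟨V ⊓ V', inf_le_left.trans hV, ⟨hxV, hxV'⟩,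
      Sec.res inf_le_left t + Sec.res inf_le_right t', ?_⟩
    rw [map_add, Sec.map_res, Sec.map_res, ht, ht', map_add, Sec.res_res, Sec.res_res]
  smul_mem' := by
    intro f s hs x hx
    obtain ⟨V, hV, hxV, t, ht⟩ := hs x hx
    exact ⟨V, hV, hxV, Hol.res hV f • t, by rw [map_smul, ht, Sec.res_smul]⟩

lemma imageSec_res {U V : Opens X} (h : V ≤ U) {s : Sec G.val U} (hs : s ∈ imageSec φ U) :
    Sec.res h s ∈ imageSec φ V := by
  intro x hx
  obtain ⟨W, hW, hxW, t, ht⟩ := hs x (h hx)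
  refine ⟨W ⊓ V, inf_le_right, ⟨hxW, hx⟩, Sec.res inf_le_left t, ?_⟩
  rw [Sec.map_res, ht, Sec.res_res, Sec.res_res]

/-- The restriction of local images. -/
def imageRes {U V : Opens X} (h : V ≤ U) : imageSec φ U →+ imageSec φ V where
  toFun s := ⟨Sec.res h s.1, imageSec_res φ h s.2⟩
  map_zero' := Subtype.ext (map_zero (Sec.res h))
  map_add' s t := Subtype.ext (map_add (Sec.res h) s.1 t.1)

/-- The presheaf of abelian groups underlying the image sheaf. -/
def imageAb : (Opens (TopCat.of X))ᵒᵖ ⥤ Ab where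
  obj U := AddCommGrpCat.of (imageSec (X := X) φ U.unop)
  map i := AddCommGrpCat.ofHom (imageRes φ i.unop.le)
  map_id U := AddCommGrpCat.hom_ext (AddMonoidHom.ext fun s => Subtype.ext
    (Sec.res_self (X := X) (U := U.unop) le_rfl s.1))
  map_comp i k := AddCommGrpCat.hom_ext (AddMonoidHom.ext fun s => Subtype.ext
    (Sec.res_res (X := X) i.unop.le k.unop.le s.1).symm)

instance (U : (Opens (TopCat.of X))ᵒᵖ) :
    Module ((structureSheaf n X).obj.obj U) ((imageAb φ).obj U) :=
  inferInstanceAs (Module (Hol n (X := X) U.unop) (imageSec (X := X) φ U.unop))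

instance (U : (Opens (TopCat.of X))ᵒᵖ) :
    Module ((structureSheaf n X).obj.obj U) (imageSec (X := X) φ U.unop) :=
  inferInstanceAs (Module (Hol n (X := X) U.unop) (imageSec (X := X) φ U.unop))

/-- The image of `φ` as a sheaf of modules. -/
def imageSheaf : OMod n X where
  val := PresheafOfModules.ofPresheaf (imageAb φ) fun _ _ i f s =>
    Subtype.ext (Sec.res_smul (X := X) i.unop.le f s.1)
  isSheaf := by
    refine (TopCat.Presheaf.isSheaf_iff_isSheafUniqueGluing (X := TopCat.of X) (imageAb φ)).2 ?_
    intro ι U j hj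
    obtain ⟨s, hs, hs'⟩ := Sec.glue G U (le_iSup U) le_rfl
      (fun i => (j i : imageSec (X := X) φ (U i)).1)
      fun i k => congrArg (fun a : imageSec (X := X) φ (U i ⊓ U k) => a.1) (hj i k)
    refine ⟨(⟨s, fun x hx => ?_⟩ : imageSec (X := X) φ (iSup U)), fun i => Subtype.ext (hs i),
      fun y hy => Subtype.ext (hs' _ fun i =>
        congrArg (fun a : imageSec (X := X) φ (U i) => a.1) (hy i))⟩
    obtain ⟨i, hi⟩ := Opens.mem_iSup.1 hx
    obtain ⟨V, hV, hxV, t, ht⟩ := (j i : imageSec (X := X) φ (U i)).2 x hi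
    refine ⟨V, hV.trans (le_iSup U i), hxV, t, ?_⟩
    rw [ht, ← hs i, Sec.res_res]

/-- The inclusion of the image. -/
def imageIncl : imageSheaf φ ⟶ G where
  val :=
    { app U := ModuleCat.ofHom (X := imageSec (X := X) φ U.unop) (Y := Sec (X := X) G.val U.unop)
        (imageSec (X := X) φ U.unop).subtype
      naturality := fun _ => rfl }

/-- The morphism to the image. -/
def toImageSheaf : F ⟶ imageSheaf φ where
  val :=
    { app U := ModuleCat.ofHom (X := Sec (X := X) F.val U.unop) (Y := imageSec (X := X) φ U.unop)
        ((Sec.map (X := X) φ.val U.unop).codRestrict _ fun t x hx =>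
          ⟨U.unop, le_rfl, hx, t, (Sec.res_self (X := X) _ _).symm⟩)
      naturality := fun i => by
        ext t
        exact Subtype.ext (Sec.map_res (X := X) φ.val i.unop.le t) }

lemma toImageSheaf_incl : toImageSheaf φ ≫ imageIncl φ = φ := rfl

/-- The inclusion of the image sheaf is a monomorphism, and an epimorphism because `φ` factors
through it. In an abelian category it is then an isomorphism, so every section of `G` is locally in
the image. -/
lemma exists_local_lift [Epi φ] {U : Opens X} (s : Sec G.val U) {x : X} (hx : x ∈ U) :
    ∃ (V : Opens X) (hV : V ≤ U) (_ : x ∈ V) (t : Sec F.val V),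
      Sec.map φ.val V t = Sec.res hV s := by
  have : Epi (imageIncl φ) := epi_of_epi_fac (toImageSheaf_incl φ)
  have : Mono (imageIncl φ) := (SheafOfModules.forget _).mono_of_mono_map
    (PresheafOfModules.mono_of_injective fun U => Subtype.val_injective)
  have : IsIso (imageIncl φ) := isIso_of_mono_of_epi _
  let t : imageSec φ U := Sec.map (inv (imageIncl φ)).val U s
  have ht : t.1 = s := congrArg (fun ψ : G ⟶ G => Sec.map ψ.val U s) (IsIso.inv_hom_id (imageIncl φ))
  exact ht ▸ t.2 x hx

end image

/-! ### Induced connections on cohomology -/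
namespace ConnectionFamily
variable {K : CochainComplex (OMod n X) ℤ} (γ : ConnectionFamily K) (i : ℤ)

/-- The connection induced on the cocycles. -/
def onCycles : HolConnection (K.cycles i) where
  toHom := HomologicalComplex.cyclesMap γ.toChainMap i ≫ inv (jetCycles K i)
  split := by
    -- The splitting may be checked in `Kⁱ`, where it is that of `γⁱ`.
    rw [← cancel_mono (K.iCycles i), Category.assoc, Category.assoc]
    have h : inv (jetCycles K i) ≫ (jetFunctor n X).map (K.iCycles i) =
        (jetComplex K).iCycles i := by rw [IsIso.inv_comp_eq, jetCycles_i]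
    have h' := (jetProjection n X).naturality (K.iCycles i)
    rw [Functor.id_map] at h'
    erw [← h']
    rw [reassoc_of% h, HomologicalComplex.cyclesMap_i_assoc]
    erw [(γ.conn i).split]
    simp

lemma onCycles_horizontal_iCycles : (γ.onCycles i).Horizontal (γ.conn i) (K.iCycles i) := by
  have h : inv (jetCycles K i) ≫ (jetFunctor n X).map (K.iCycles i) =
      (jetComplex K).iCycles i := by rw [IsIso.inv_comp_eq, jetCycles_i]
  simp only [HolConnection.Horizontal, onCycles, Category.assoc, h,
    HomologicalComplex.cyclesMap_i]
  rfl

variable [HasDerivedCategory (OMod n X)]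

/-- For a gauge field that comes from a chain map the derived category drops out by naturality of
`derivedHomologyIso`. -/
lemma onCohomology_toHom : (γ.toGaugeField.onCohomology i).toHom =
    HomologicalComplex.homologyMap γ.toChainMap i ≫ jetHomology K i := by
  simp only [GaugeField.onCohomology, toGaugeField]
  rw [← Category.assoc (DerivedCategory.homologyFunctor (OMod n X) i |>.map _),
    derivedHomologyIso_naturality]
  simp

lemma onCycles_horizontal_homologyπ :
    (γ.onCycles i).Horizontal (γ.toGaugeField.onCohomology i) (K.homologyπ i) := by
  rw [HolConnection.Horizontal, onCohomology_toHom, HomologicalComplex.homologyπ_naturality_assoc,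
    homologyπ_jetHomology]
  simp [onCycles]

/-- If the connections on the terms of a complex are flat, then so are the induced connections on
cohomology. -/
theorem onCohomology_curvature_eq_zero
    (hγ : ∀ (U : Opens X) (D E : VecField n U) (s : Sec (K.X i).val U),
      (γ.conn i).curvature D E s = 0)
    {U : Opens X} (D E : VecField n U) (s : Sec (K.homology i).val U) :
    (γ.toGaugeField.onCohomology i).curvature D E s = 0 := by
  -- Lift a cohomology class locally to a cocycle. Its curvature is zero because cocycles inject
  -- into `Kⁱ`, and curvature commutes with both maps.
  choose N hN hxN t ht using fun x : U => exists_local_lift (K.homologyπ i) s x.2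
  refine Sec.eq_of_locally_eq _ N hN (fun x hx => Opens.mem_iSup.2 ⟨⟨x, hx⟩, hxN ⟨x, hx⟩⟩) _ _
    fun x => ?_
  rw [map_zero, ← HolConnection.curvature_res, ← ht x,
    ← (γ.onCycles_horizontal_homologyπ i).curvature]
  have : (γ.onCycles i).curvature (VecField.res (hN x) D) (VecField.res (hN x) E) (t x) = 0 := by
    refine cycles_injective K i _ ?_
    rw [(γ.onCycles_horizontal_iCycles i).curvature, hγ, map_zero]
  rw [this, map_zero]

end ConnectionFamily
end HolGauge

namespace HolGauge
variable {n : ℕ} {X : Type} [TopologicalSpace X] [ChartedSpace (Cn n) X]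

/-! ### Flat connections have no curvature norm -/

/-- A connection with vanishing curvature. -/
def HolConnection.IsFlat {F : OMod n X} (c : HolConnection F) : Prop :=
  ∀ (U : Opens X) (D E : VecField n U) (s : Sec F.val U), c.curvature D E s = 0

section
variable {F : OMod n X} {g : Pairing (tangentPresheaf n X)} {h : Pairing F.val}
  {c : HolConnection F} (hc : c.IsFlat) (H : IsHermitianMetric h)
include hc H

lemma HolConnection.IsFlat.curvatureDensity_eq_zero : curvatureDensity g h c = 0 := by
  funext x
  have h0 : ∀ p : UnitaryFrame g x n × Σ r, UnitaryFrame h x r,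
      curvatureDensityOn g h c p.1 p.2.2 = 0 := by
    intro p
    rw [curvatureDensityOn]
    refine Finset.sum_eq_zero fun j _ => Finset.sum_eq_zero fun k _ => ?_
    refine mul_eq_zero_of_right _ (Finset.sum_eq_zero fun a _ => ?_)
    simp only [hc _ _ _ _]
    rw [H.zero_left (U := p.1.dom ⊓ p.2.2.dom) ⟨p.1.mem, p.2.2.mem⟩, Complex.zero_re]
  -- A real supremum of zeros is `0`, also over an empty family of frames.
  simp [curvatureDensity, h0]

variable [IsManifold 𝓘(ℂ, Cn n) ω X] [MeasurableSpace X]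

lemma HolConnection.IsFlat.finiteCurvature : FiniteCurvature g h c := by
  rw [FiniteCurvature, hc.curvatureDensity_eq_zero H]
  exact integrableOn_zero

lemma HolConnection.IsFlat.curvatureNormSq_eq_zero : curvatureNormSq g h c = 0 := by
  rw [curvatureNormSq, hc.curvatureDensity_eq_zero H]
  simp

end

lemma ConnectionFamily.isFlat_onCohomology [HasDerivedCategory (OMod n X)]
    {K : CochainComplex (OMod n X) ℤ} {γ : ConnectionFamily K} (hγ : ∀ i, (γ.conn i).IsFlat)
    (i : ℤ) : (γ.toGaugeField.onCohomology i).IsFlat :=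
  fun _ D E s => γ.onCohomology_curvature_eq_zero i (hγ i) D E s

section
variable [IsManifold 𝓘(ℂ, Cn n) ω X]

lemma HolConnection.singularSet_eq_empty {F : OMod n X} (c : HolConnection F)
    (hF : IsCoherent F.val) : singularSet F.val = ∅ :=
  Set.eq_empty_of_forall_notMem fun x hx => hx (locallyFreeAt_of_connection hF c x)

lemma HolConnection.MetricCompatible.isFlat {F : OMod n X} {c : HolConnection F}
    {h : Pairing F.val} (hc : c.MetricCompatible h) (H : IsHermitianMetric h)
    (hF : IsCoherent F.val) : c.IsFlat :=
  fun _ D E s => hc.curvature_eq_zero H (c.singularSet_eq_empty hF) D E s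

lemma ConnectionFamily.eulerNormSq_eq_zero [MeasurableSpace X]
    {K : CochainComplex (OMod n X) ℤ} {γ : ConnectionFamily K} (hγ : ∀ i, (γ.conn i).IsFlat)
    (g : Pairing (tangentPresheaf n X)) {h : ∀ i, Pairing (K.X i).val}
    (H : ∀ i, IsHermitianMetric (h i)) : γ.eulerNormSq g h = 0 := by
  simp [eulerNormSq, fun i => (hγ i).curvatureNormSq_eq_zero (g := g) (H i)]

lemma ConnectionFamily.yangMills_eq_zero [HasDerivedCategory (OMod n X)] [MeasurableSpace X]
    {K : CochainComplex (OMod n X) ℤ} {γ : ConnectionFamily K} (hγ : ∀ i, (γ.conn i).IsFlat)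
    (g : Pairing (tangentPresheaf n X)) {h : ∀ i, Pairing (K.homology i).val}
    (H : ∀ i, IsHermitianMetric (h i)) : γ.toGaugeField.yangMills g h = 0 := by
  simp [GaugeField.yangMills,
    fun i => (isFlat_onCohomology hγ i).curvatureNormSq_eq_zero (g := g) (H i)]

end

/-! ### The metric on the mapping cone -/
section cone
variable {A B : CochainComplex (OMod n X) ℤ} {f : A ⟶ B}
  {mA : ∀ i, Pairing (A.X i).val} {mB : ∀ i, Pairing (B.X i).val}

/-- Empty singular sets make both summands smooth on all of `U`, so no comparison with the singular
set of the sum is needed. -/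
lemma isHermitianMetric_cone (hmA : ∀ i, IsHermitianMetric (mA i))
    (hmB : ∀ i, IsHermitianMetric (mB i)) (hA : ∀ i, singularSet (A.X i).val = ∅)
    (hB : ∀ i, singularSet (B.X i).val = ∅) (i : ℤ) : IsHermitianMetric (coneMetric f mA mB i) where
  res U V hV s t x hx := by
    simp only [coneMetric, Sec.map_res]
    rw [(hmA _).res U V hV _ _ x hx, (hmB _).res U V hV _ _ x hx]
  add_left U s s' t x hx := by
    simp only [coneMetric, map_add]
    rw [(hmA _).add_left U _ _ _ x hx, (hmB _).add_left U _ _ _ x hx]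
    ring
  smul_left U f s t x hx := by
    simp only [coneMetric, map_smul]
    rw [(hmA _).smul_left U _ _ _ x hx, (hmB _).smul_left U _ _ _ x hx]
    ring
  conj_symm U s t x hx := by
    simp only [coneMetric, map_add]
    rw [← (hmA _).conj_symm U _ _ x hx, ← (hmB _).conj_symm U _ _ x hx]
  nonneg U s x hx := add_nonneg ((hmA _).nonneg U _ x hx) ((hmB _).nonneg U _ x hx)
  definite U s x hx := by
    have key : VanishesAt s x ↔ VanishesAt (Sec.map (coneFst f i).val U s) x ∧
        VanishesAt (Sec.map (coneSnd f i).val U s) x := (coneSum f i).vanishesAt_iff s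
    rw [← (hmA _).definite U _ x hx, ← (hmB _).definite U _ x hx] at key
    -- Two non-negative real parts with sum zero are both zero; the imaginary parts vanish by
    -- conjugate symmetry.
    refine Iff.trans ⟨fun h => ?_, fun h => ?_⟩ key.symm
    · have h1 := (hmA (i + 1)).nonneg U (Sec.map (coneFst f i).val U s) x hx
      have h2 := (hmB i).nonneg U (Sec.map (coneSnd f i).val U s) x hx
      have h3 := congrArg Complex.re h
      simp only [coneMetric, Complex.add_re, Complex.zero_re] at h3
      exact ⟨Complex.ext (by simp only [Complex.zero_re]; exact le_antisymm (by linarith) h1)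
          ((hmA _).im_self hx _),
        Complex.ext (by simp only [Complex.zero_re]; exact le_antisymm (by linarith) h2)
          ((hmB _).im_self hx _)⟩
    · exact (congrArg₂ (· + ·) h.1 h.2).trans (add_zero 0)
  locally_bounded U s t x hx := by
    obtain ⟨V, hV, M, hM⟩ := (hmA (i + 1)).locally_bounded U (Sec.map (coneFst f i).val U s)
      (Sec.map (coneFst f i).val U t) x hx
    obtain ⟨V', hV', M', hM'⟩ := (hmB i).locally_bounded U (Sec.map (coneSnd f i).val U s)
      (Sec.map (coneSnd f i).val U t) x hx
    exact ⟨V ⊓ V', ⟨hV, hV'⟩, M + M', fun y hy => (norm_add_le _ _).trans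
      (add_le_add (hM y ⟨hy.1.1, hy.2⟩) (hM' y ⟨hy.1.2, hy.2⟩))⟩
  smooth U s t := by
    have h1 := (hmA (i + 1)).smooth U (Sec.map (coneFst f i).val U s)
      (Sec.map (coneFst f i).val U t)
    have h2 := (hmB i).smooth U (Sec.map (coneSnd f i).val U s) (Sec.map (coneSnd f i).val U t)
    rw [hA, Set.sdiff_empty] at h1
    rw [hB, Set.sdiff_empty] at h2
    exact (h1.add h2).mono Set.sdiff_subset

variable [IsManifold 𝓘(ℂ, Cn n) ω X]

lemma metricCompatible_cone {α : ConnectionFamily A} {β : ConnectionFamily B}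
    (hf : ∀ i, (α.conn i).Horizontal (β.conn i) (f.f i))
    (hmA : ∀ i, IsHermitianMetric (mA i)) (hmB : ∀ i, IsHermitianMetric (mB i))
    (hα : ∀ i, (α.conn i).MetricCompatible (mA i)) (hβ : ∀ i, (β.conn i).MetricCompatible (mB i))
    (hA : ∀ i, singularSet (A.X i).val = ∅) (hB : ∀ i, singularSet (B.X i).val = ∅) (i : ℤ) :
    ((α.cone β f hf).conn i).MetricCompatible (coneMetric f mA mB i) := by
  intro U D s t x hx _
  have h1 := realDeriv_add
    (((hmA (i + 1)).contMDiffAt_pairing (hA _) (Sec.map (coneFst f i).val U s)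
      (Sec.map (coneFst f i).val U t) hx).mdifferentiableAt (by simp))
    (((hmB i).contMDiffAt_pairing (hB _) (Sec.map (coneSnd f i).val U s)
      (Sec.map (coneSnd f i).val U t) hx).mdifferentiableAt (by simp)) (D.value x hx)
  refine h1.trans ?_
  rw [(hα (i + 1)).realDeriv_pairing (hA _), (hβ i).realDeriv_pairing (hB _)]
  simp only [coneMetric, (cone_horizontal_fst f i α β hf).cov, (cone_horizontal_snd f i α β hf).cov]
  ring

end cone
end HolGauge
end

theorem proposition3p3 {n : ℕ} (X : Type) [TopologicalSpace X] [T2Space X] [CompactSpace X]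
    [ConnectedSpace X] [ChartedSpace (Cn n) X] [IsManifold 𝓘(ℂ, Cn n) ω X]
    [MeasurableSpace X] [BorelSpace X] [HasDerivedCategory (OMod n X)]
    (g : Pairing (tangentPresheaf n X)) (hg : IsKahler g)
    (A B : CochainComplex (OMod n X) ℤ) (hA : IsBrane A) (hB : IsBrane B) (f : A ⟶ B)
    (α : ConnectionFamily A) (β : ConnectionFamily B)
    (hf : ∀ i, (α.conn i).Horizontal (β.conn i) (f.f i))
    (mA : ∀ i, Pairing (A.X i).val) (mB : ∀ i, Pairing (B.X i).val)
    (hmA : ∀ i, IsHermitianMetric (mA i)) (hmB : ∀ i, IsHermitianMetric (mB i))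
    (hα : ∀ i, (α.conn i).MetricCompatible (mA i)) (hβ : ∀ i, (β.conn i).MetricCompatible (mB i)) :
    IsBrane (CochainComplex.mappingCone f) ∧
    (∀ γ : ConnectionFamily (CochainComplex.mappingCone f),
      γ.IsDirectSum α β ↔ γ = α.cone β f hf) ∧
    (∀ i, IsHermitianMetric (coneMetric f mA mB i) ∧
      ((α.cone β f hf).conn i).MetricCompatible (coneMetric f mA mB i)) ∧
    ((∀ i, FiniteCurvature g (mA i) (α.conn i) ∧ FiniteCurvature g (mB i) (β.conn i) ∧
        FiniteCurvature g (coneMetric f mA mB i) ((α.cone β f hf).conn i)) ∧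
      β.eulerNormSq g mB - α.eulerNormSq g mA =
        (α.cone β f hf).eulerNormSq g (coneMetric f mA mB)) ∧
    ∀ (kA : ∀ i, Pairing (A.homology i).val) (kB : ∀ i, Pairing (B.homology i).val)
      (kC : ∀ i, Pairing ((CochainComplex.mappingCone f).homology i).val),
      (∀ i, IsHermitianMetric (kA i)) → (∀ i, IsHermitianMetric (kB i)) →
      (∀ i, IsHermitianMetric (kC i)) →
      (∀ i, FiniteCurvature g (kA i) (α.toGaugeField.onCohomology i) ∧
        FiniteCurvature g (kB i) (β.toGaugeField.onCohomology i) ∧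
        FiniteCurvature g (kC i) ((α.cone β f hf).toGaugeField.onCohomology i)) ∧
      β.toGaugeField.yangMills g kB - α.toGaugeField.yangMills g kA =
        (α.cone β f hf).toGaugeField.yangMills g kC := by
  -- Local freeness comes before the metrics: smoothness and compatibility on the cone rely on it.
  have sA := fun i => (α.conn i).singularSet_eq_empty (hA.coherent i)
  have sB := fun i => (β.conn i).singularSet_eq_empty (hB.coherent i)
  have hC : IsBrane (CochainComplex.mappingCone f) := hA.mappingCone hB
  have hmC := isHermitianMetric_cone (f := f) hmA hmB sA sB
  have hγ := metricCompatible_cone hf hmA hmB hα hβ sA sB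
  have flatA := fun i => (hα i).isFlat (hmA i) (hA.coherent i)
  have flatB := fun i => (hβ i).isFlat (hmB i) (hB.coherent i)
  -- The cone satisfies the same assumptions as `A` and `B`, so its flatness needs no separate
  -- argument.
  have flatC := fun i => (hγ i).isFlat (hmC i) (hC.coherent i)
  refine ⟨hC, cone_isDirectSum_iff α β hf, fun i => ⟨hmC i, hγ i⟩,
    ⟨fun i => ⟨(flatA i).finiteCurvature (hmA i), (flatB i).finiteCurvature (hmB i),
      (flatC i).finiteCurvature (hmC i)⟩, ?_⟩, fun kA kB kC hkA hkB hkC => ⟨fun i =>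
    ⟨(ConnectionFamily.isFlat_onCohomology flatA i).finiteCurvature (hkA i),
      (ConnectionFamily.isFlat_onCohomology flatB i).finiteCurvature (hkB i),
      (ConnectionFamily.isFlat_onCohomology flatC i).finiteCurvature (hkC i)⟩, ?_⟩⟩
  -- Every summand of the three alternating sums is zero.
  · rw [ConnectionFamily.eulerNormSq_eq_zero flatA g hmA,
      ConnectionFamily.eulerNormSq_eq_zero flatB g hmB,
      ConnectionFamily.eulerNormSq_eq_zero flatC g hmC, sub_zero]
  · rw [ConnectionFamily.yangMills_eq_zero flatA g hkA,
      ConnectionFamily.yangMills_eq_zero flatB g hkB,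
      ConnectionFamily.yangMills_eq_zero flatC g hkC, sub_zero]
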